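/- For positive integers $n$ and $d_1,\dots,d_n$, a \emph{multivariate resultant} of $n$ forms in $n$ variables of degrees $d_1,\dots,d_n$ is a polynomial $\mathrm{Res}$ with integer coefficients in the coefficients of the forms which is irreducible over $\mathbb{Z}$, vanishes whenever the forms $f_1,\dots,f_n$ (with coefficients in any field) have a common non-zero root, and satisfies $\mathrm{Res}(x_1^{d_1},\dots,x_n^{d_n})=1$. There is exactly one multivariate resultant $\mathrm{Res}$ of three ternary cubic forms. For a ternary quartic form $Q$ over a commutative ring, put $\mathrm{Disc}\,Q=\mathrm{Res}\left(\frac{\partial Q}{\partial x},\frac{\partial Q}{\partial y},\frac{\partial Q}{\partial z}\right)$. Let $K$ be a field of characteristic different from $2$, let $a_1,a_2,a_3,b_1,b_2,b_3\in K$, and let $$m=\begin{pmatrix}a_1&b_3&b_2\\ b_3&a_2&b_1\\ b_2&b_1&a_3\end{pmatrix},\qquad Q_m={}^t v\,m\,v\ \text{ with } v=(x^2,y^2,z^2),$$ that is, $Q_m=a_1x^4+a_2y^4+a_3z^4+2(b_1y^2z^2+b_2x^2z^2+b_3x^2y^2)$. Let $c_1=a_2a_3-b_1^2$, $c_2=a_1a_3-b_2^2$,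 $c_3=a_1a_2-b_3^2$. Then $$\mathrm{Disc}\,Q_m=2^{54}\,a_1a_2a_3\,(c_1c_2c_3)^2\,(\det m)^4 .$$ Moreover, the plane projective curve $X_m: Q_m=0$ is nonsingular (that is, $Q_m$ and its three partial derivatives have no common zero in $\mathbb{P}^2(\overline{K})$) if and only if $a_1a_2a_3\,c_1c_2c_3\det m\neq 0$. -/

import Mathlib

namespace Ciani

open MvPolynomial

/-- Index set of the coefficients of `n` generic forms in `n` variables, the `i`-th one of
degree `d i`: pairs `(i, ν)` with `ν` an exponent of total degree `d i`. -/
abbrev CoeffIndex {n : ℕ} (d : Fin n → ℕ) : Type :=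
  Σ i : Fin n, {ν : Fin n →₀ ℕ // ν.degree = d i}

/-- The family of coefficients of the forms `f 0, …, f (n - 1)` of degrees `d 0, …, d (n - 1)`. -/
noncomputable def formCoeffs {n : ℕ} {A : Type*} [CommRing A] (d : Fin n → ℕ)
    (f : Fin n → MvPolynomial (Fin n) A) : CoeffIndex d → A :=
  fun p => (f p.1).coeff p.2.1

/-- `R` is a multivariate resultant of `n` forms in `n` variables of degrees `d i`: it is a
polynomial with integral coefficients in the coefficients of the forms, it is irreducible
over `ℤ`, it vanishes whenever the forms (over any field) have a common non-zero root, and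
it takes the value `1` at `(x₁ ^ d₁, …, xₙ ^ dₙ)`. -/
structure IsMultivariateResultant {n : ℕ} (d : Fin n → ℕ)
    (R : MvPolynomial (CoeffIndex d) ℤ) : Prop where
  irreducible : Irreducible R
  vanishes : ∀ (L : Type) [Field L] (f : Fin n → MvPolynomial (Fin n) L),
    (∀ i, (f i).IsHomogeneous (d i)) →
    (∃ v : Fin n → L, v ≠ 0 ∧ ∀ i, eval v (f i) = 0) →
    aeval (formCoeffs d f) R = 0
  normalized : aeval (formCoeffs d (fun i => (X i : MvPolynomial (Fin n) ℤ) ^ d i)) R = 1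

/-- The universal multivariate resultant in degrees `d`. -/
noncomputable def multivariateResultant {n : ℕ} (d : Fin n → ℕ) :
    MvPolynomial (CoeffIndex d) ℤ :=
  Classical.epsilon (IsMultivariateResultant d)

/-- `Res(f₁, …, fₙ)`, for forms `f i` of degree `d i`. -/
noncomputable def res {n : ℕ} {A : Type*} [CommRing A] (d : Fin n → ℕ)
    (f : Fin n → MvPolynomial (Fin n) A) : A :=
  aeval (formCoeffs d f) (multivariateResultant d)

/-- The discriminant of a ternary form `Q` of degree `d`: the resultant of its three partial
derivatives, which are forms of degree `d - 1`. -/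
noncomputable def disc {A : Type*} [CommRing A] (d : ℕ) (Q : MvPolynomial (Fin 3) A) : A :=
  res (fun _ : Fin 3 => d - 1) (fun i => pderiv i Q)

/-- The symmetric matrix `m` with diagonal entries `a₁, a₂, a₃` and off-diagonal entries
`b₁, b₂, b₃`. -/
def symMatrix {K : Type*} (a₁ a₂ a₃ b₁ b₂ b₃ : K) : Matrix (Fin 3) (Fin 3) K :=
  !![a₁, b₃, b₂;
     b₃, a₂, b₁;
     b₂, b₁, a₃]

/-- The ternary quartic `Q_m(x, y, z) = ᵗv m v` with `v = (x², y², z²)`. -/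
noncomputable def cianiForm {K : Type*} [CommRing K] (m : Matrix (Fin 3) (Fin 3) K) :
    MvPolynomial (Fin 3) K :=
  ∑ i, ∑ j, C (m i j) * X i ^ 2 * X j ^ 2

/-- The plane projective curve `Q = 0` is nonsingular: no geometric point of the projective
plane is a zero of `Q` and of its three partial derivatives. -/
def IsNonsingularPlaneCurve {K : Type*} [Field K] (Q : MvPolynomial (Fin 3) K) : Prop :=
  ∀ v : Fin 3 → AlgebraicClosure K, v ≠ 0 → aeval v Q = 0 →
    ∃ i, aeval v (pderiv i Q) ≠ 0

end Ciani

/-!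
The resultant of three ternary cubics is the determinant `D` of Sylvester's matrix of size 15. Its
rows are the coefficients of quartic forms that vanish at every common root of the cubics
`f₀, f₁, f₂`: the nine products `xⱼ fᵢ`, and six determinants (the Sylvester forms) of the matrices of
coefficients in decompositions `fᵢ = Aᵢ x₀ᵃ + Bᵢ x₁ᵇ + Gᵢ x₂ᶜ` with `a + b + c = 5`. The matrix kills
the vector of quartic monomials at a common root, so `D` vanishes there
(`det_sylvesterMatrix_eq_zero`), and it is the identity matrix for the cubes of the variables.

Consider the generic system of cubics with the root `(t₀, t₁, 1)` (`genericPoint`). The polynomials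
vanishing at it form a prime ideal `𝔭`, which contains every resultant and also `D`.

* Irreducibility of `D`. Some irreducible factor `P` of `D` lies in `𝔭`. The determinant has degree at
  most nine in each form (`natDegree_det_sylvesterMatrix_le`). On the other hand, fix two cubics with
  nine common rational points and let the third one run through a pencil that meets these points for
  nine different parameters; since `P` is in `𝔭`, it vanishes for these parameters, and it is not
  zero on the whole pencil because the pencil reduces modulo 2 to the cubes of the variables. So `P`
  has degree nine in each form as well (`nine_le_natDegree_shiftForm`), and `D / P` is a constant, in
  fact a unit because `D` takes the value 1.
* Uniqueness. The ideal `𝔭` has height one (`associated_of_irreducible`): two irreducible elements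
  that are not associated would yield, by elimination of the coefficient of `x₂³` in `f₂`, a non-zero
  element `h` of `𝔭` not involving that coefficient. There is none (`eq_zero_of_pderiv_eq_zero`): by the
  chain rule and the non-vanishing of the Jacobian of `f₀, f₁` with respect to `t₀, t₁`, the partial
  derivatives of `h` by the coefficients of `x₂³` in `f₀` and `f₁` are in `𝔭` again, and a
  counterexample of least degree would be free of all three coefficients of `x₂³`; but the other
  coefficients of the generic system are algebraically independent.

The partial derivatives of the Ciani form of `m` are `4 xᵢ (∑ₖ mᵢₖ xₖ²)`. Sylvester's matrix of such a
system respects the grading of the quartic monomials by the parities of the exponents; it splits into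
a block of size 6 and three blocks of size 3, whose determinants are computed directly
(`det_evenBlock`, `det_oddBlock`).

Away from characteristic 2, a singular point of the curve is a non-zero `v` with
`vᵢ (∑ₖ mᵢₖ vₖ²) = 0` for all `i`, that is, a kernel vector `(vₖ²)` of the principal submatrix of `m` on
the support of `v`. Over an algebraically closed field one exists if and only if some principal minor
of `m` vanishes (`exists_mul_mulVec_eq_zero_iff`).
-/

namespace Ciani

open MvPolynomial

variable {A B : Type*} [CommRing A] [CommRing B]

/-! ### Ternary cubic forms and their coefficients -/

/-- The index set of the coefficients of three ternary cubic forms. -/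
abbrev CubicIndex : Type := CoeffIndex (fun _ : Fin 3 => 3)

/-- The exponent of the monomial `xⱼ xₖ xₗ`. -/
def tripleExp (j k l : Fin 3) : Fin 3 → ℕ := fun t =>
  (if t = j then 1 else 0) + (if t = k then 1 else 0) + (if t = l then 1 else 0)

/-- The index of the coefficient of `xⱼ xₖ xₗ` in the `i`-th of three ternary cubic forms. -/
noncomputable def cubicIndex (i j k l : Fin 3) : CubicIndex :=
  ⟨i, Finsupp.equivFunOnFinite.symm (tripleExp j k l), by
    rw [Finsupp.degree_eq_sum]
    simp [tripleExp, Finset.sum_add_distrib]⟩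

theorem cubicIndex_swap_right (i j k l : Fin 3) : cubicIndex i j k l = cubicIndex i j l k := by
  have h : tripleExp j k l = tripleExp j l k := by
    funext t; simp only [tripleExp]; ring
  simp only [cubicIndex, h]

theorem cubicIndex_swap_left (i j k l : Fin 3) : cubicIndex i j k l = cubicIndex i k j l := by
  have h : tripleExp j k l = tripleExp k j l := by
    funext t; simp only [tripleExp]; ring
  simp only [cubicIndex, h]

/-- The `i`-th of the three ternary cubic forms with coefficients `c`. -/
noncomputable def cubicForm {A : Type*} [CommRing A] (c : CubicIndex → A) (i : Fin 3) :
    MvPolynomial (Fin 3) A :=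
  C (c (cubicIndex i 0 0 0)) * X 0 ^ 3 + C (c (cubicIndex i 0 0 1)) * (X 0 ^ 2 * X 1) +
  C (c (cubicIndex i 0 0 2)) * (X 0 ^ 2 * X 2) + C (c (cubicIndex i 0 1 1)) * (X 0 * X 1 ^ 2) +
  C (c (cubicIndex i 0 1 2)) * (X 0 * X 1 * X 2) + C (c (cubicIndex i 0 2 2)) * (X 0 * X 2 ^ 2) +
  C (c (cubicIndex i 1 1 1)) * X 1 ^ 3 + C (c (cubicIndex i 1 1 2)) * (X 1 ^ 2 * X 2) +
  C (c (cubicIndex i 1 2 2)) * (X 1 * X 2 ^ 2) + C (c (cubicIndex i 2 2 2)) * X 2 ^ 3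

theorem map_cubicForm (φ : A →+* B) (c : CubicIndex → A) (i : Fin 3) :
    map φ (cubicForm c i) = cubicForm (φ ∘ c) i := by
  simp [cubicForm]

theorem cubicForm_isHomogeneous (c : CubicIndex → A) (i : Fin 3) :
    (cubicForm c i).IsHomogeneous 3 := by
  have h1 (j : Fin 3) : (X j : MvPolynomial (Fin 3) A).IsHomogeneous 1 := isHomogeneous_X A j
  have key (a : A) {P : MvPolynomial (Fin 3) A} (hP : P.IsHomogeneous 3) :
      (C a * P).IsHomogeneous 3 := by
    simpa using (isHomogeneous_C (Fin 3) a).mul hP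
  unfold cubicForm
  refine ((((((((((key _ ?_).add (key _ ?_)).add (key _ ?_)).add (key _ ?_)).add (key _ ?_)).add
    (key _ ?_)).add (key _ ?_)).add (key _ ?_)).add (key _ ?_)).add (key _ ?_))
  · exact (h1 0).pow 3
  · exact ((h1 0).pow 2).mul (h1 1)
  · exact ((h1 0).pow 2).mul (h1 2)
  · exact (h1 0).mul ((h1 1).pow 2)
  · exact ((h1 0).mul (h1 1)).mul (h1 2)
  · exact (h1 0).mul ((h1 2).pow 2)
  · exact (h1 1).pow 3
  · exact ((h1 1).pow 2).mul (h1 2)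
  · exact (h1 1).mul ((h1 2).pow 2)
  · exact (h1 2).pow 3

theorem C_mul_X_mul_X_mul_X (a : A) (j k l : Fin 3) :
    C a * (X j * X k * X l) =
      monomial (Finsupp.equivFunOnFinite.symm (tripleExp j k l)) a := by
  have : (Finsupp.equivFunOnFinite.symm (tripleExp j k l) : Fin 3 →₀ ℕ) =
      Finsupp.single j 1 + Finsupp.single k 1 + Finsupp.single l 1 := by
    ext t
    simp [tripleExp, Finsupp.single_apply, eq_comm]
  rw [this, X, X, X, monomial_mul, monomial_mul, C_mul_monomial]
  simp

theorem eq_tripleExp_of_sum_eq_three (ν : Fin 3 → ℕ) (h : ν 0 + ν 1 + ν 2 = 3) :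
    ν = tripleExp 0 0 0 ∨ ν = tripleExp 0 0 1 ∨ ν = tripleExp 0 0 2 ∨ ν = tripleExp 0 1 1 ∨
    ν = tripleExp 0 1 2 ∨ ν = tripleExp 0 2 2 ∨ ν = tripleExp 1 1 1 ∨ ν = tripleExp 1 1 2 ∨
    ν = tripleExp 1 2 2 ∨ ν = tripleExp 2 2 2 := by
  have hν : ν = ![ν 0, ν 1, ν 2] := by
    funext t; fin_cases t <;> rfl
  generalize ν 0 = a at h hν
  generalize ν 1 = b at h hν
  generalize ν 2 = d at h hν
  obtain rfl : d = 3 - a - b := by omega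
  have ha : a ≤ 3 := by omega
  have hb : b ≤ 3 := by omega
  subst hν
  interval_cases a <;> interval_cases b <;> first | omega | decide

/-- Every coefficient index of three ternary cubics is one of the ten listed ones. -/
theorem cubicIndex_cases (p : CubicIndex) :
    p = cubicIndex p.1 0 0 0 ∨ p = cubicIndex p.1 0 0 1 ∨ p = cubicIndex p.1 0 0 2 ∨
    p = cubicIndex p.1 0 1 1 ∨ p = cubicIndex p.1 0 1 2 ∨ p = cubicIndex p.1 0 2 2 ∨
    p = cubicIndex p.1 1 1 1 ∨ p = cubicIndex p.1 1 1 2 ∨ p = cubicIndex p.1 1 2 2 ∨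
    p = cubicIndex p.1 2 2 2 := by
  obtain ⟨i, ν, hν⟩ := p
  rw [Finsupp.degree_eq_sum, Fin.sum_univ_three] at hν
  have key (j k l : Fin 3) (h : (ν : Fin 3 → ℕ) = tripleExp j k l) :
      (⟨i, ν, by rw [Finsupp.degree_eq_sum, Fin.sum_univ_three]; exact hν⟩ : CubicIndex) =
        cubicIndex i j k l := by
    have : ν = Finsupp.equivFunOnFinite.symm (tripleExp j k l) := by
      ext t; simp [h]
    subst this
    rfl
  rcases eq_tripleExp_of_sum_eq_three ν hν with h | h | h | h | h | h | h | h | h | h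
  all_goals have := key _ _ _ h; simp [this]

theorem cubicIndex_inj {i j k l i' j' k' l' : Fin 3} :
    cubicIndex i j k l = cubicIndex i' j' k' l' ↔
      i = i' ∧ tripleExp j k l = tripleExp j' k' l' := by
  constructor
  · intro h
    refine ⟨congrArg Sigma.fst h, ?_⟩
    have h2 := congrArg (fun p : CubicIndex => (p.2.1 : Fin 3 → ℕ)) h
    simpa [cubicIndex] using h2
  · rintro ⟨rfl, h⟩
    simp only [cubicIndex, h]

theorem cubicForm_eq_sum_monomial (c : CubicIndex → A) (i : Fin 3) :
    cubicForm c i =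
      (([(0, 0, 0), (0, 0, 1), (0, 0, 2), (0, 1, 1), (0, 1, 2), (0, 2, 2), (1, 1, 1), (1, 1, 2),
        (1, 2, 2), (2, 2, 2)] : List (Fin 3 × Fin 3 × Fin 3)).map fun t =>
          monomial (cubicIndex i t.1 t.2.1 t.2.2).2.1 (c (cubicIndex i t.1 t.2.1 t.2.2))).sum := by
  simp only [List.map_cons, List.map_nil, List.sum_cons, List.sum_nil, cubicForm, cubicIndex,
    ← C_mul_X_mul_X_mul_X]
  ring

theorem coeff_cubicForm (c : CubicIndex → A) (p : CubicIndex) :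
    coeff p.2.1 (cubicForm c p.1) = c p := by
  have key (i j k l j' k' l' : Fin 3) (a : A) :
      coeff (cubicIndex i j k l).2.1 (monomial (cubicIndex i j' k' l').2.1 a) =
        if tripleExp j k l = tripleExp j' k' l' then a else 0 := by
    rw [coeff_monomial]
    simp [cubicIndex, eq_comm]
  have main (i j k l : Fin 3) (h : (j, k, l) ∈ ([(0, 0, 0), (0, 0, 1), (0, 0, 2), (0, 1, 1),
      (0, 1, 2), (0, 2, 2), (1, 1, 1), (1, 1, 2), (1, 2, 2), (2, 2, 2)] :
        List (Fin 3 × Fin 3 × Fin 3))) :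
      coeff (cubicIndex i j k l).2.1 (cubicForm c i) = c (cubicIndex i j k l) := by
    rw [cubicForm_eq_sum_monomial]
    simp only [List.map_cons, List.map_nil, List.sum_cons, List.sum_nil, coeff_add, coeff_zero,
      key]
    simp only [List.mem_cons, List.not_mem_nil, Prod.mk.injEq, or_false] at h
    rcases h with ⟨rfl, rfl, rfl⟩ | ⟨rfl, rfl, rfl⟩ | ⟨rfl, rfl, rfl⟩ | ⟨rfl, rfl, rfl⟩ |
      ⟨rfl, rfl, rfl⟩ | ⟨rfl, rfl, rfl⟩ | ⟨rfl, rfl, rfl⟩ | ⟨rfl, rfl, rfl⟩ | ⟨rfl, rfl, rfl⟩ |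
      ⟨rfl, rfl, rfl⟩
    all_goals simp +decide
  rcases cubicIndex_cases p with h | h | h | h | h | h | h | h | h | h
  all_goals rw [h]; exact main _ _ _ _ (by decide)

theorem formCoeffs_cubicForm (c : CubicIndex → A) :
    formCoeffs (fun _ : Fin 3 => 3) (cubicForm c) = c :=
  funext fun p => coeff_cubicForm c p

theorem cubicForm_formCoeffs {f : Fin 3 → MvPolynomial (Fin 3) A}
    (hf : ∀ i, (f i).IsHomogeneous 3) :
    cubicForm (formCoeffs (fun _ : Fin 3 => 3) f) = f := by
  funext i
  ext ν
  by_cases hν : ν.degree = 3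
  · exact coeff_cubicForm _ (⟨i, ν, hν⟩ : CubicIndex)
  · rw [(hf i).coeff_eq_zero hν, (cubicForm_isHomogeneous _ i).coeff_eq_zero hν]

/-! ### Sylvester's matrix of three ternary cubics -/

/-- The rows and columns of Sylvester's matrix, in bijection with the monomials of degree four;
the outer summands separate the monomials all of whose exponents are even from the others. -/
abbrev QuarticIndex : Type := (Fin 3 ⊕ Fin 3) ⊕ (Fin 3 × Fin 3)

/-- The exponent of the monomial of degree four with the given index. The indices `inr (s, p)`
belong to the monomials whose exponent is odd exactly at `p + 1` and `p + 2`. -/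
def quarticExp : QuarticIndex → Fin 3 → ℕ
  | .inl (.inl p) => fun t => if t = p then 4 else 0
  | .inl (.inr p) => fun t => if t = p then 0 else 2
  | .inr (s, p) => fun t => ![if t = p then 2 else 1,
      if t = p + 1 then 3 else if t = p + 2 then 1 else 0,
      if t = p + 2 then 3 else if t = p + 1 then 1 else 0] s

/-- `quarticExp` as a finitely supported function. -/
noncomputable def quarticExponent (s : QuarticIndex) : Fin 3 →₀ ℕ :=
  Finsupp.equivFunOnFinite.symm (quarticExp s)

theorem quarticExp_injective : Function.Injective quarticExp := by
  decide

theorem quarticExponent_injective : Function.Injective quarticExponent :=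
  Finsupp.equivFunOnFinite.symm.injective.comp quarticExp_injective

theorem exists_quarticExponent_eq (ν : Fin 3 →₀ ℕ) (h : ν.degree = 4) :
    ∃ s, quarticExponent s = ν := by
  suffices ∃ s, quarticExp s = ν by
    obtain ⟨s, hs⟩ := this
    refine ⟨s, ?_⟩
    ext t
    simp [quarticExponent, hs]
  rw [Finsupp.degree_eq_sum, Fin.sum_univ_three] at h
  generalize (ν : Fin 3 → ℕ) = ν at h
  have hν : ν = ![ν 0, ν 1, ν 2] := by
    funext t; fin_cases t <;> rfl
  generalize ν 0 = a at h hν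
  generalize ν 1 = b at h hν
  generalize ν 2 = d at h hν
  obtain rfl : d = 4 - a - b := by omega
  have ha : a ≤ 4 := by omega
  have hb : b ≤ 4 := by omega
  subst hν
  interval_cases a <;> interval_cases b <;> first | omega | decide

/-- The matrix whose determinant is the Sylvester form of three ternary cubics at the exponent
`2eₚ`. Its rows are the triples `(A, B, G)` in decompositions `f = A xₚ³ + B x_{p+1} + G x_{p+2}` of
the cubics `fₚ, f_{p+1}, f_{p+2}`, so that the determinant vanishes at every common root. Monomials
divisible by `x_{p+1}` are put into `B`. -/
noncomputable def sylvesterA (c : CubicIndex → A) (p : Fin 3) :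
    Matrix (Fin 3) (Fin 3) (MvPolynomial (Fin 3) A) := fun s =>
  ![C (c (cubicIndex (p + s) p p p)),
    C (c (cubicIndex (p + s) (p + 1) (p + 1) (p + 1))) * X (p + 1) ^ 2 +
    C (c (cubicIndex (p + s) (p + 1) (p + 1) p)) * (X (p + 1) * X p) +
    C (c (cubicIndex (p + s) (p + 1) (p + 1) (p + 2))) * (X (p + 1) * X (p + 2)) +
    C (c (cubicIndex (p + s) (p + 1) p p)) * X p ^ 2 +
    C (c (cubicIndex (p + s) (p + 1) p (p + 2))) * (X p * X (p + 2)) +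
    C (c (cubicIndex (p + s) (p + 1) (p + 2) (p + 2))) * X (p + 2) ^ 2,
    C (c (cubicIndex (p + s) (p + 2) (p + 2) (p + 2))) * X (p + 2) ^ 2 +
    C (c (cubicIndex (p + s) (p + 2) (p + 2) p)) * (X (p + 2) * X p) +
    C (c (cubicIndex (p + s) (p + 2) p p)) * X p ^ 2]

/-- The matrix whose determinant is the Sylvester form of three ternary cubics at the exponent
`e_{p+1} + e_{p+2}`: its rows are the triples `(A, B, G)` in decompositions
`f = A xₚ + B x_{p+1}² + G x_{p+2}²` of the cubics `fₚ, f_{p+1}, f_{p+2}`. Monomials divisible by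
`xₚ` are put into `A`. -/
noncomputable def sylvesterB (c : CubicIndex → A) (p : Fin 3) :
    Matrix (Fin 3) (Fin 3) (MvPolynomial (Fin 3) A) := fun s =>
  ![C (c (cubicIndex (p + s) p p p)) * X p ^ 2 +
    C (c (cubicIndex (p + s) p p (p + 1))) * (X p * X (p + 1)) +
    C (c (cubicIndex (p + s) p p (p + 2))) * (X p * X (p + 2)) +
    C (c (cubicIndex (p + s) p (p + 1) (p + 1))) * X (p + 1) ^ 2 +
    C (c (cubicIndex (p + s) p (p + 1) (p + 2))) * (X (p + 1) * X (p + 2)) +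
    C (c (cubicIndex (p + s) p (p + 2) (p + 2))) * X (p + 2) ^ 2,
    C (c (cubicIndex (p + s) (p + 1) (p + 1) (p + 1))) * X (p + 1) +
    C (c (cubicIndex (p + s) (p + 1) (p + 1) (p + 2))) * X (p + 2),
    C (c (cubicIndex (p + s) (p + 2) (p + 2) (p + 2))) * X (p + 2) +
    C (c (cubicIndex (p + s) (p + 2) (p + 2) (p + 1))) * X (p + 1)]

/-- Rewriting rules that put the variables of a monomial into increasing order. -/
theorem cubicIndex_sort (i : Fin 3) :
    (∀ k, cubicIndex i 1 0 k = cubicIndex i 0 1 k) ∧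
    (∀ k, cubicIndex i 2 0 k = cubicIndex i 0 2 k) ∧
    (∀ k, cubicIndex i 2 1 k = cubicIndex i 1 2 k) ∧
    (∀ k, cubicIndex i k 1 0 = cubicIndex i k 0 1) ∧
    (∀ k, cubicIndex i k 2 0 = cubicIndex i k 0 2) ∧
    (∀ k, cubicIndex i k 2 1 = cubicIndex i k 1 2) :=
  ⟨fun _ => cubicIndex_swap_left .., fun _ => cubicIndex_swap_left ..,
    fun _ => cubicIndex_swap_left .., fun _ => cubicIndex_swap_right ..,
    fun _ => cubicIndex_swap_right .., fun _ => cubicIndex_swap_right ..⟩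

theorem cubicForm_eq_sylvesterA (c : CubicIndex → A) (p s : Fin 3) :
    cubicForm c (p + s) = sylvesterA c p s 0 * X p ^ 3 + sylvesterA c p s 1 * X (p + 1) +
      sylvesterA c p s 2 * X (p + 2) := by
  generalize hi : p + s = i
  simp only [sylvesterA, hi, Matrix.cons_val]
  fin_cases p
  · simp [cubicForm, cubicIndex_sort i]
    ring
  · simp [cubicForm, cubicIndex_sort i]
    ring
  · simp [cubicForm, cubicIndex_sort i]
    ring

theorem cubicForm_eq_sylvesterB (c : CubicIndex → A) (p s : Fin 3) :
    cubicForm c (p + s) = sylvesterB c p s 0 * X p + sylvesterB c p s 1 * X (p + 1) ^ 2 +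
      sylvesterB c p s 2 * X (p + 2) ^ 2 := by
  generalize hi : p + s = i
  simp only [sylvesterB, hi, Matrix.cons_val]
  fin_cases p
  · simp [cubicForm, cubicIndex_sort i]
    ring
  · simp [cubicForm, cubicIndex_sort i]
    ring
  · simp [cubicForm, cubicIndex_sort i]
    ring

/-- The quartic forms whose coefficients are the rows of Sylvester's matrix: the nine products of
a variable and one of the cubics, and the six Sylvester forms. The rows are matched with the
monomials in such a way that the system of the cubes of the variables gives the identity matrix. -/
noncomputable def quarticRow (c : CubicIndex → A) : QuarticIndex → MvPolynomial (Fin 3) A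
  | .inl (.inl p) => X p * cubicForm c p
  | .inl (.inr p) => (sylvesterA c p).det
  | .inr (s, p) => ![(sylvesterB c p).det, X (p + 2) * cubicForm c (p + 1),
      X (p + 1) * cubicForm c (p + 2)] s

/-- Sylvester's matrix of three ternary cubics. -/
noncomputable def sylvesterMatrix (c : CubicIndex → A) : Matrix QuarticIndex QuarticIndex A :=
  fun r s => coeff (quarticExponent s) (quarticRow c r)

theorem map_sylvesterA (φ : A →+* B) (c : CubicIndex → A) (p : Fin 3) :
    (map φ).mapMatrix (sylvesterA c p) = sylvesterA (φ ∘ c) p := by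
  ext1 i j
  fin_cases j <;> simp [sylvesterA]

theorem map_sylvesterB (φ : A →+* B) (c : CubicIndex → A) (p : Fin 3) :
    (map φ).mapMatrix (sylvesterB c p) = sylvesterB (φ ∘ c) p := by
  ext1 i j
  fin_cases j <;> simp [sylvesterB]

theorem map_quarticRow (φ : A →+* B) (c : CubicIndex → A) (r : QuarticIndex) :
    map φ (quarticRow c r) = quarticRow (φ ∘ c) r := by
  rcases r with (p | p) | ⟨s, p⟩
  · simp [quarticRow, map_cubicForm]
  · simp only [quarticRow, RingHom.map_det, map_sylvesterA]
  · fin_cases s <;> simp [quarticRow, map_cubicForm, RingHom.map_det]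
    rw [← map_sylvesterB]; rfl

theorem map_sylvesterMatrix (φ : A →+* B) (c : CubicIndex → A) :
    φ.mapMatrix (sylvesterMatrix c) = sylvesterMatrix (φ ∘ c) := by
  ext r s
  simp [sylvesterMatrix, ← map_quarticRow, coeff_map]

theorem map_det_sylvesterMatrix (φ : A →+* B) (c : CubicIndex → A) :
    φ (sylvesterMatrix c).det = (sylvesterMatrix (φ ∘ c)).det := by
  rw [RingHom.map_det, map_sylvesterMatrix]

theorem sylvesterA_isHomogeneous (c : CubicIndex → A) (p s j : Fin 3) :
    (sylvesterA c p s j).IsHomogeneous (![0, 2, 2] j) := by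
  have h1 (j : Fin 3) : (X j : MvPolynomial (Fin 3) A).IsHomogeneous 1 := isHomogeneous_X A j
  have key (a : A) {n : ℕ} {P : MvPolynomial (Fin 3) A} (hP : P.IsHomogeneous n) :
      (C a * P).IsHomogeneous n := by
    simpa using (isHomogeneous_C (Fin 3) a).mul hP
  fin_cases j
  · exact isHomogeneous_C _ _
  · exact ((((((key _ ((h1 _).pow 2)).add (key _ ((h1 _).mul (h1 _)))).add
      (key _ ((h1 _).mul (h1 _)))).add (key _ ((h1 _).pow 2))).add
      (key _ ((h1 _).mul (h1 _)))).add (key _ ((h1 _).pow 2)))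
  · exact (((key _ ((h1 _).pow 2)).add (key _ ((h1 _).mul (h1 _)))).add (key _ ((h1 _).pow 2)))

theorem sylvesterB_isHomogeneous (c : CubicIndex → A) (p s j : Fin 3) :
    (sylvesterB c p s j).IsHomogeneous (![2, 1, 1] j) := by
  have h1 (j : Fin 3) : (X j : MvPolynomial (Fin 3) A).IsHomogeneous 1 := isHomogeneous_X A j
  have key (a : A) {n : ℕ} {P : MvPolynomial (Fin 3) A} (hP : P.IsHomogeneous n) :
      (C a * P).IsHomogeneous n := by
    simpa using (isHomogeneous_C (Fin 3) a).mul hP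
  fin_cases j
  · exact ((((((key _ ((h1 _).pow 2)).add (key _ ((h1 _).mul (h1 _)))).add
      (key _ ((h1 _).mul (h1 _)))).add (key _ ((h1 _).pow 2))).add
      (key _ ((h1 _).mul (h1 _)))).add (key _ ((h1 _).pow 2)))
  · exact ((key _ (h1 _)).add (key _ (h1 _)))
  · exact ((key _ (h1 _)).add (key _ (h1 _)))

theorem det_isHomogeneous {M : Matrix (Fin 3) (Fin 3) (MvPolynomial (Fin 3) A)} {d : Fin 3 → ℕ}
    (h : ∀ i j, (M i j).IsHomogeneous (d j)) : M.det.IsHomogeneous (∑ j, d j) := by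
  rw [Matrix.det_apply]
  refine IsHomogeneous.sum _ _ _ fun σ _ => ?_
  have := IsHomogeneous.prod Finset.univ (fun j => M (σ j) j) d fun j _ => h _ _
  rcases Int.units_eq_one_or (Equiv.Perm.sign σ) with hσ | hσ
  · simpa [hσ] using this
  · simpa [hσ] using this.neg

theorem quarticRow_isHomogeneous (c : CubicIndex → A) (r : QuarticIndex) :
    (quarticRow c r).IsHomogeneous 4 := by
  have h1 (j i : Fin 3) : (X j * cubicForm c i).IsHomogeneous 4 :=
    (isHomogeneous_X A j).mul (cubicForm_isHomogeneous c i)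
  rcases r with (p | p) | ⟨s, p⟩
  · exact h1 _ _
  · exact det_isHomogeneous (d := ![0, 2, 2]) fun i j => sylvesterA_isHomogeneous c p i j
  · fin_cases s
    · exact det_isHomogeneous (d := ![2, 1, 1]) fun i j => sylvesterB_isHomogeneous c p i j
    · exact h1 _ _
    · exact h1 _ _

theorem eq_sum_quarticExponent {P : MvPolynomial (Fin 3) A} (hP : P.IsHomogeneous 4) :
    P = ∑ s, monomial (quarticExponent s) (coeff (quarticExponent s) P) := by
  ext ν
  simp only [coeff_sum, coeff_monomial]
  by_cases hν : ν.degree = 4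
  · obtain ⟨s, rfl⟩ := exists_quarticExponent_eq ν hν
    simp [quarticExponent_injective.eq_iff]
  · rw [hP.coeff_eq_zero hν, Finset.sum_eq_zero]
    intro s _
    split_ifs with h
    · rw [h, hP.coeff_eq_zero hν]
    · rfl

/-- The monomials of degree four at `v`, as a vector, are mapped by Sylvester's matrix to the values
at `v` of the forms that make up its rows. -/
theorem sylvesterMatrix_mulVec (c : CubicIndex → A) (v : Fin 3 → A) :
    Matrix.mulVec (sylvesterMatrix c) (fun s => ∏ t, v t ^ quarticExp s t) =
      fun r => eval v (quarticRow c r) := by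
  funext r
  conv_rhs => rw [eq_sum_quarticExponent (quarticRow_isHomogeneous c r)]
  simp [Matrix.mulVec, dotProduct, sylvesterMatrix, eval_monomial, Finsupp.prod_fintype,
    quarticExponent]

/-- A determinant of forms vanishes at a point where its matrix kills a non-zero vector. This is why
the Sylvester forms vanish at a common root. -/
theorem det_eval_eq_zero [IsDomain A] (M : Matrix (Fin 3) (Fin 3) (MvPolynomial (Fin 3) A))
    (v w : Fin 3 → A) (hw : w ≠ 0) (h : ∀ i, ∑ j, eval v (M i j) * w j = 0) :
    eval v M.det = 0 := by
  rw [RingHom.map_det]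
  exact Matrix.exists_mulVec_eq_zero_iff.1 ⟨w, hw, funext fun i => h i⟩

/-- Sylvester's determinant vanishes at every system with a common non-zero root. -/
theorem det_sylvesterMatrix_eq_zero [IsDomain A] (c : CubicIndex → A) (v : Fin 3 → A) (hv : v ≠ 0)
    (h : ∀ i, eval v (cubicForm c i) = 0) : (sylvesterMatrix c).det = 0 := by
  obtain ⟨k, hk⟩ : ∃ k, v k ≠ 0 := Function.ne_iff.1 hv
  have cover (p k : Fin 3) : k = p ∨ k = p + 1 ∨ k = p + 2 := by revert p k; decide
  have hA (p : Fin 3) : eval v (sylvesterA c p).det = 0 := by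
    refine det_eval_eq_zero _ v ![v p ^ 3, v (p + 1), v (p + 2)] (fun h0 => hk ?_) fun s => ?_
    · have h0 := funext_iff.1 h0
      rcases cover p k with rfl | rfl | rfl
      · simpa using h0 0
      · simpa using h0 1
      · simpa using h0 2
    · have := h (p + s)
      rw [cubicForm_eq_sylvesterA] at this
      simpa [Fin.sum_univ_three] using this
  have hB (p : Fin 3) : eval v (sylvesterB c p).det = 0 := by
    refine det_eval_eq_zero _ v ![v p, v (p + 1) ^ 2, v (p + 2) ^ 2] (fun h0 => hk ?_) fun s => ?_
    · have h0 := funext_iff.1 h0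
      rcases cover p k with rfl | rfl | rfl
      · simpa using h0 0
      · simpa using h0 1
      · simpa using h0 2
    · have := h (p + s)
      rw [cubicForm_eq_sylvesterB] at this
      simpa [Fin.sum_univ_three] using this
  refine Matrix.exists_mulVec_eq_zero_iff.1
    ⟨fun s => ∏ t, v t ^ quarticExp s t, fun h0 => hk ?_, ?_⟩
  · have := congrFun h0 (.inl (.inl k))
    simpa [quarticExp, Finset.prod_eq_zero_iff] using this
  · rw [sylvesterMatrix_mulVec]
    funext r
    rcases r with (p | p) | ⟨s, p⟩
    · simp [quarticRow, h]
    · exact hA p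
    · fin_cases s
      · exact hB p
      · simp [quarticRow, h]
      · simp [quarticRow, h]

/-! ### Sylvester's determinant of a system `xᵢ (∑ₖ nᵢₖ xₖ²)` -/

/-- The cubics `xᵢ (∑ₖ nᵢₖ xₖ²)`. For symmetric `n` they are, up to a factor `4`, the partial
derivatives of the Ciani form of `n`; for `n = 1` they are the cubes of the variables. -/
noncomputable def evenSystem (n : Matrix (Fin 3) (Fin 3) A) (i : Fin 3) :
    MvPolynomial (Fin 3) A :=
  ∑ k, C (n i k) * (X i * X k * X k)

theorem formCoeffs_evenSystem (n : Matrix (Fin 3) (Fin 3) A) (i j k l : Fin 3) :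
    formCoeffs (fun _ : Fin 3 => 3) (evenSystem n) (cubicIndex i j k l) =
      ∑ t, if tripleExp i t t = tripleExp j k l then n i t else 0 := by
  simp [formCoeffs, evenSystem, C_mul_X_mul_X_mul_X, coeff_sum, coeff_monomial, cubicIndex]

theorem monomial_quarticExponent (s : QuarticIndex) (a : A) :
    monomial (quarticExponent s) a =
      C a * (X 0 ^ quarticExp s 0 * X 1 ^ quarticExp s 1 * X 2 ^ quarticExp s 2) := by
  rw [monomial_eq, Finsupp.prod_fintype _ _ (by simp), Fin.prod_univ_three]
  rfl

section Rows

variable (n : Matrix (Fin 3) (Fin 3) A)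

theorem cubicForm_evenSystem :
    cubicForm (formCoeffs (fun _ : Fin 3 => 3) (evenSystem n)) = evenSystem n := by
  refine cubicForm_formCoeffs fun i => IsHomogeneous.sum _ _ _ fun k _ => ?_
  rw [C_mul_X_mul_X_mul_X]
  exact isHomogeneous_monomial _ (cubicIndex i i k k).2.2

theorem quarticRow_evenSystem_variable (p : Fin 3) :
    quarticRow (formCoeffs (fun _ : Fin 3 => 3) (evenSystem n)) (.inl (.inl p)) =
      monomial (quarticExponent (.inl (.inl p))) (n p p) +
      monomial (quarticExponent (.inl (.inr (p + 2)))) (n p (p + 1)) +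
      monomial (quarticExponent (.inl (.inr (p + 1)))) (n p (p + 2)) := by
  simp only [quarticRow, cubicForm_evenSystem, evenSystem, monomial_quarticExponent]
  fin_cases p <;> simp [Fin.sum_univ_three, quarticExp] <;> ring

theorem quarticRow_evenSystem_sylvesterA (p : Fin 3) :
    quarticRow (formCoeffs (fun _ : Fin 3 => 3) (evenSystem n)) (.inl (.inr p)) =
      monomial (quarticExponent (.inl (.inl p))) (n p p * n (p + 1) p * n (p + 2) p) +
      monomial (quarticExponent (.inl (.inl (p + 2))))
        (n p p * n (p + 1) (p + 2) * n (p + 2) (p + 2)) +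
      monomial (quarticExponent (.inl (.inr p)))
        (n p p * n (p + 1) (p + 1) * n (p + 2) (p + 2)) +
      monomial (quarticExponent (.inl (.inr (p + 1))))
        (n p p * (n (p + 1) p * n (p + 2) (p + 2) + n (p + 1) (p + 2) * n (p + 2) p)) +
      monomial (quarticExponent (.inl (.inr (p + 2))))
        (n p p * n (p + 1) (p + 1) * n (p + 2) p) := by
  simp only [quarticRow, sylvesterA, Matrix.det_fin_three, formCoeffs_evenSystem,
    monomial_quarticExponent]
  fin_cases p
  · simp +decide [Fin.sum_univ_three, quarticExp]
    ring
  · simp +decide [Fin.sum_univ_three, quarticExp]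
    ring
  · simp +decide [Fin.sum_univ_three, quarticExp]
    ring

theorem quarticRow_evenSystem_sylvesterB (p : Fin 3) :
    quarticRow (formCoeffs (fun _ : Fin 3 => 3) (evenSystem n)) (.inr (0, p)) =
      ∑ s, monomial (quarticExponent (.inr (s, p))) (n p (p + s) *
        (n (p + 1) (p + 1) * n (p + 2) (p + 2) - n (p + 1) (p + 2) * n (p + 2) (p + 1))) := by
  simp only [quarticRow, sylvesterB, Matrix.det_fin_three, formCoeffs_evenSystem,
    monomial_quarticExponent, Fin.sum_univ_three]
  fin_cases p
  · simp +decide [quarticExp]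
    ring
  · simp +decide [quarticExp]
    ring
  · simp +decide [quarticExp]
    ring

theorem quarticRow_evenSystem_inr_one (p : Fin 3) :
    quarticRow (formCoeffs (fun _ : Fin 3 => 3) (evenSystem n)) (.inr (1, p)) =
      ∑ s, monomial (quarticExponent (.inr (s, p))) (n (p + 1) (p + s)) := by
  simp only [quarticRow, cubicForm_evenSystem, evenSystem, monomial_quarticExponent,
    Fin.sum_univ_three]
  fin_cases p <;> simp [quarticExp] <;> ring

theorem quarticRow_evenSystem_inr_two (p : Fin 3) :
    quarticRow (formCoeffs (fun _ : Fin 3 => 3) (evenSystem n)) (.inr (2, p)) =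
      ∑ s, monomial (quarticExponent (.inr (s, p))) (n (p + 2) (p + s)) := by
  simp only [quarticRow, cubicForm_evenSystem, evenSystem, monomial_quarticExponent,
    Fin.sum_univ_three]
  fin_cases p <;> simp [quarticExp] <;> ring

end Rows

/-- The block of Sylvester's matrix of `evenSystem n` on the monomials with even exponents. -/
def evenBlock (n : Matrix (Fin 3) (Fin 3) A) : Matrix (Fin 3 ⊕ Fin 3) (Fin 3 ⊕ Fin 3) A :=
  Matrix.fromBlocks (Matrix.diagonal fun p => n p p)
    !![0, n 0 2, n 0 1; n 1 2, 0, n 1 0; n 2 1, n 2 0, 0]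
    !![n 0 0 * n 1 0 * n 2 0, 0, n 0 0 * n 1 2 * n 2 2;
       n 1 1 * n 2 0 * n 0 0, n 1 1 * n 2 1 * n 0 1, 0;
       0, n 2 2 * n 0 1 * n 1 1, n 2 2 * n 0 2 * n 1 2]
    !![n 0 0 * n 1 1 * n 2 2, n 0 0 * (n 1 0 * n 2 2 + n 1 2 * n 2 0), n 0 0 * n 1 1 * n 2 0;
       n 1 1 * n 2 2 * n 0 1, n 1 1 * n 2 2 * n 0 0, n 1 1 * (n 2 1 * n 0 0 + n 2 0 * n 0 1);
       n 2 2 * (n 0 2 * n 1 1 + n 0 1 * n 1 2), n 2 2 * n 0 0 * n 1 2, n 2 2 * n 0 0 * n 1 1]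

/-- The block of Sylvester's matrix of `evenSystem n` on the monomials whose exponent is odd exactly
at `p + 1` and `p + 2`. -/
def oddBlock (n : Matrix (Fin 3) (Fin 3) A) (p : Fin 3) : Matrix (Fin 3) (Fin 3) A :=
  .of fun r s => ![n p (p + s) *
    (n (p + 1) (p + 1) * n (p + 2) (p + 2) - n (p + 1) (p + 2) * n (p + 2) (p + 1)),
    n (p + 1) (p + s), n (p + 2) (p + s)] r

/-- The `i`-th form of `evenSystem n` is `xᵢ` times a form in the squares of the variables, so the
matrix is compatible with the grading of the monomials by the parities of their exponents. -/
theorem sylvesterMatrix_evenSystem (n : Matrix (Fin 3) (Fin 3) A) :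
    sylvesterMatrix (formCoeffs (fun _ : Fin 3 => 3) (evenSystem n)) =
      Matrix.fromBlocks (evenBlock n) 0 0 (Matrix.blockDiagonal (oddBlock n)) := by
  ext r s
  simp only [sylvesterMatrix]
  rcases r with (p | p) | ⟨r, p⟩
  · rw [quarticRow_evenSystem_variable]
    simp only [coeff_add, coeff_monomial, quarticExponent_injective.eq_iff]
    rcases s with (q | q) | ⟨s, q⟩
    · fin_cases p <;> fin_cases q <;> simp [evenBlock]
    · fin_cases p <;> fin_cases q <;> simp [evenBlock]
    · simp
  · rw [quarticRow_evenSystem_sylvesterA]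
    simp only [coeff_add, coeff_monomial, quarticExponent_injective.eq_iff]
    rcases s with (q | q) | ⟨s, q⟩
    · fin_cases p <;> fin_cases q <;> simp [evenBlock]
    · fin_cases p <;> fin_cases q <;> simp [evenBlock]
    · simp
  · have key (g : Fin 3 → A) : coeff (quarticExponent s)
        (∑ t, monomial (quarticExponent (.inr (t, p))) (g t)) =
        Sum.elim (fun _ => 0) (fun t : Fin 3 × Fin 3 => if p = t.2 then g t.1 else 0) s := by
      simp only [coeff_sum, coeff_monomial, quarticExponent_injective.eq_iff]
      rcases s with s | ⟨s, q⟩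
      · simp
      · by_cases h : p = q <;> simp [h]
    fin_cases r
    · refine (congrArg _ (quarticRow_evenSystem_sylvesterB n p)).trans ((key _).trans ?_)
      rcases s with s | ⟨s, q⟩ <;> simp [Matrix.blockDiagonal_apply, oddBlock]
    · refine (congrArg _ (quarticRow_evenSystem_inr_one n p)).trans ((key _).trans ?_)
      rcases s with s | ⟨s, q⟩ <;> simp [Matrix.blockDiagonal_apply, oddBlock]
    · refine (congrArg _ (quarticRow_evenSystem_inr_two n p)).trans ((key _).trans ?_)
      rcases s with s | ⟨s, q⟩ <;> simp [Matrix.blockDiagonal_apply, oddBlock]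

theorem det_oddBlock (n : Matrix (Fin 3) (Fin 3) A) (p : Fin 3) :
    (oddBlock n p).det =
      (n (p + 1) (p + 1) * n (p + 2) (p + 2) - n (p + 1) (p + 2) * n (p + 2) (p + 1)) * n.det := by
  rw [Matrix.det_fin_three, Matrix.det_fin_three]
  fin_cases p <;> simp [oddBlock] <;> ring

theorem det_evenBlock (n : Matrix (Fin 3) (Fin 3) A) :
    (evenBlock n).det = n 0 0 * n 1 1 * n 2 2 *
      ((n 1 1 * n 2 2 - n 1 2 * n 2 1) * (n 2 2 * n 0 0 - n 2 0 * n 0 2) *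
        (n 0 0 * n 1 1 - n 0 1 * n 1 0)) * n.det := by
  rw [← Matrix.det_submatrix_equiv_self finSumFinEquiv.symm]
  have : (evenBlock n).submatrix (finSumFinEquiv (m := 3) (n := 3)).symm finSumFinEquiv.symm =
    !![n 0 0, 0, 0, 0, n 0 2, n 0 1;
       0, n 1 1, 0, n 1 2, 0, n 1 0;
       0, 0, n 2 2, n 2 1, n 2 0, 0;
       n 0 0 * n 1 0 * n 2 0, 0, n 0 0 * n 1 2 * n 2 2, n 0 0 * n 1 1 * n 2 2,
         n 0 0 * (n 1 0 * n 2 2 + n 1 2 * n 2 0), n 0 0 * n 1 1 * n 2 0;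
       n 1 1 * n 2 0 * n 0 0, n 1 1 * n 2 1 * n 0 1, 0, n 1 1 * n 2 2 * n 0 1,
         n 1 1 * n 2 2 * n 0 0, n 1 1 * (n 2 1 * n 0 0 + n 2 0 * n 0 1);
       0, n 2 2 * n 0 1 * n 1 1, n 2 2 * n 0 2 * n 1 2,
         n 2 2 * (n 0 2 * n 1 1 + n 0 1 * n 1 2), n 2 2 * n 0 0 * n 1 2,
         n 2 2 * n 0 0 * n 1 1] := by
    ext i j
    fin_cases i <;> fin_cases j <;> rfl
  rw [this]
  simp [Matrix.det_succ_row_zero, Fin.sum_univ_succ, Fin.succAbove]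
  ring

theorem det_sylvesterMatrix_evenSystem (n : Matrix (Fin 3) (Fin 3) A) :
    (sylvesterMatrix (formCoeffs (fun _ : Fin 3 => 3) (evenSystem n))).det =
      n 0 0 * n 1 1 * n 2 2 *
      ((n 1 1 * n 2 2 - n 1 2 * n 2 1) * (n 2 2 * n 0 0 - n 2 0 * n 0 2) *
        (n 0 0 * n 1 1 - n 0 1 * n 1 0)) ^ 2 * n.det ^ 4 := by
  rw [sylvesterMatrix_evenSystem, Matrix.det_fromBlocks_zero₂₁, Matrix.det_blockDiagonal,
    det_evenBlock, Fin.prod_univ_three, det_oddBlock, det_oddBlock, det_oddBlock]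
  simp only [Fin.isValue, zero_add, show (1 : Fin 3) + 1 = 2 from rfl,
    show (1 : Fin 3) + 2 = 0 from rfl, show (2 : Fin 3) + 1 = 0 from rfl,
    show (2 : Fin 3) + 2 = 1 from rfl]
  ring

theorem evenSystem_one : evenSystem (1 : Matrix (Fin 3) (Fin 3) A) = fun i => X i ^ 3 := by
  funext i
  rw [evenSystem, Finset.sum_eq_single i]
  · simp; ring
  · intro k _ hk
    simp [Matrix.one_apply_ne' hk]
  · simp

/-! ### Sylvester's determinant as a universal polynomial -/

/-- Sylvester's determinant of three ternary cubics, as a polynomial in their coefficients. -/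
noncomputable def sylvesterResultant : MvPolynomial CubicIndex ℤ :=
  (sylvesterMatrix X).det

/-- The value of an integral polynomial at elements of a commutative ring. In contrast to `aeval`
it does not depend on an instance of a `ℤ`-algebra structure. -/
noncomputable def evalCoeffs {σ : Type*} (c : σ → A) : MvPolynomial σ ℤ →+* A :=
  eval₂Hom (Int.castRingHom A) c

theorem aeval_eq_evalCoeffs {σ : Type*} [Algebra ℤ A] (c : σ → A) (P : MvPolynomial σ ℤ) :
    aeval c P = evalCoeffs c P := by
  rw [aeval_def, evalCoeffs, coe_eval₂Hom, Subsingleton.elim (algebraMap ℤ A)]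

@[simp]
theorem evalCoeffs_X {σ : Type*} (c : σ → A) (p : σ) : evalCoeffs c (X p) = c p :=
  eval₂Hom_X' _ _ _

@[simp]
theorem evalCoeffs_C {σ : Type*} (c : σ → A) (a : ℤ) : evalCoeffs c (C a) = a :=
  eval₂Hom_C _ _ _

theorem evalCoeffs_X_left {σ : Type*} (P : MvPolynomial σ ℤ) : evalCoeffs X P = P := by
  rw [← aeval_eq_evalCoeffs, aeval_X_left_apply]

theorem map_evalCoeffs {σ : Type*} (φ : A →+* B) (c : σ → A) (P : MvPolynomial σ ℤ) :
    φ (evalCoeffs c P) = evalCoeffs (φ ∘ c) P := by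
  rw [evalCoeffs, map_eval₂Hom, Subsingleton.elim (φ.comp (Int.castRingHom A)) (Int.castRingHom B)]
  rfl

theorem evalCoeffs_sylvesterResultant (c : CubicIndex → A) :
    evalCoeffs c sylvesterResultant = (sylvesterMatrix c).det := by
  refine (map_det_sylvesterMatrix (evalCoeffs c) X).trans ?_
  congr 2
  funext p
  exact evalCoeffs_X c p

theorem evalCoeffs_sylvesterResultant_eq_zero [IsDomain A] (c : CubicIndex → A) (v : Fin 3 → A)
    (hv : v ≠ 0) (h : ∀ i, eval v (cubicForm c i) = 0) : evalCoeffs c sylvesterResultant = 0 := by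
  rw [evalCoeffs_sylvesterResultant, det_sylvesterMatrix_eq_zero c v hv h]

theorem evalCoeffs_sylvesterResultant_powers :
    evalCoeffs (formCoeffs (fun _ : Fin 3 => 3) fun i => (X i : MvPolynomial (Fin 3) A) ^ 3)
      sylvesterResultant = 1 := by
  rw [evalCoeffs_sylvesterResultant, ← evenSystem_one, det_sylvesterMatrix_evenSystem]
  simp

/-! ### The degree of Sylvester's determinant in each form -/

theorem natDegree_det_le {ι : Type*} [Fintype ι] [DecidableEq ι]
    (M : Matrix ι ι (Polynomial A)) (d : ι → ℕ) (h : ∀ i j, (M i j).natDegree ≤ d i) :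
    M.det.natDegree ≤ ∑ i, d i := by
  rw [← Matrix.det_transpose, Matrix.det_apply]
  refine Polynomial.natDegree_sum_le_of_forall_le _ _ fun σ _ => ?_
  refine (Polynomial.natDegree_smul_le _ _).trans ((Polynomial.natDegree_prod_le _ _).trans ?_)
  exact Finset.sum_le_sum fun i _ => h i (σ i)

/-- All coefficients of `P` are polynomials of degree at most `d`. -/
def CoeffsNatDegreeLE (P : MvPolynomial (Fin 3) (Polynomial A)) (d : ℕ) : Prop :=
  ∀ ν, (coeff ν P).natDegree ≤ d

namespace CoeffsNatDegreeLE

variable {P Q : MvPolynomial (Fin 3) (Polynomial A)} {d e : ℕ}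

theorem add (hP : CoeffsNatDegreeLE P d) (hQ : CoeffsNatDegreeLE Q d) :
    CoeffsNatDegreeLE (P + Q) d := fun ν => by
  rw [coeff_add]
  exact Polynomial.natDegree_add_le_of_degree_le (hP ν) (hQ ν)

theorem neg (hP : CoeffsNatDegreeLE P d) : CoeffsNatDegreeLE (-P) d := fun ν => by
  rw [coeff_neg, Polynomial.natDegree_neg]
  exact hP ν

theorem sum {ι : Type*} {s : Finset ι} {f : ι → MvPolynomial (Fin 3) (Polynomial A)}
    (h : ∀ i ∈ s, CoeffsNatDegreeLE (f i) d) : CoeffsNatDegreeLE (∑ i ∈ s, f i) d := fun ν => by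
  rw [coeff_sum]
  exact Polynomial.natDegree_sum_le_of_forall_le _ _ fun i hi => h i hi ν

theorem mul (hP : CoeffsNatDegreeLE P d) (hQ : CoeffsNatDegreeLE Q e) :
    CoeffsNatDegreeLE (P * Q) (d + e) := fun ν => by
  classical
  rw [coeff_mul]
  refine Polynomial.natDegree_sum_le_of_forall_le _ _ fun x _ => ?_
  exact Polynomial.natDegree_mul_le_of_le (hP _) (hQ _)

theorem C {a : Polynomial A} (h : a.natDegree ≤ d) :
    CoeffsNatDegreeLE (MvPolynomial.C a) d := fun ν => by
  classical
  rw [coeff_C]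
  split_ifs
  · exact h
  · simp

theorem X (i : Fin 3) : CoeffsNatDegreeLE (MvPolynomial.X i : MvPolynomial (Fin 3) (Polynomial A))
    0 := fun ν => by
  classical
  rw [coeff_X]
  split_ifs <;> simp

theorem pow_zero (hP : CoeffsNatDegreeLE P 0) (k : ℕ) : CoeffsNatDegreeLE (P ^ k) 0 := by
  induction k with
  | zero => simpa using CoeffsNatDegreeLE.C (a := (1 : Polynomial A)) (d := 0) (by simp)
  | succ k ih => simpa [pow_succ] using ih.mul hP

theorem C_mul {a : Polynomial A} (h : a.natDegree ≤ d) (hP : CoeffsNatDegreeLE P 0) :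
    CoeffsNatDegreeLE (MvPolynomial.C a * P) d :=
  (CoeffsNatDegreeLE.C h).mul hP

theorem det {M : Matrix (Fin 3) (Fin 3) (MvPolynomial (Fin 3) (Polynomial A))} {d : Fin 3 → ℕ}
    (h : ∀ i j, CoeffsNatDegreeLE (M i j) (d i)) : CoeffsNatDegreeLE M.det (∑ i, d i) := by
  rw [Fin.sum_univ_three, Matrix.det_fin_three]
  have key (i j k : Fin 3) : CoeffsNatDegreeLE (M 0 i * M 1 j * M 2 k) (d 0 + d 1 + d 2) :=
    ((h 0 i).mul (h 1 j)).mul (h 2 k)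
  simp only [sub_eq_add_neg]
  exact (((((key 0 1 2).add (key 0 2 1).neg).add (by
    simpa [mul_assoc] using (key 1 0 2).neg)).add (key 1 2 0)).add (key 2 0 1)).add (key 2 1 0).neg

end CoeffsNatDegreeLE

section Degree

variable {c : CubicIndex → Polynomial A} {i : Fin 3}

theorem CoeffsNatDegreeLE.cubicForm
    (hc : ∀ p, (c p).natDegree ≤ if p.1 = i then 1 else 0) (l : Fin 3) :
    CoeffsNatDegreeLE (cubicForm c l) (if l = i then 1 else 0) := by
  have h0 (j k m : Fin 3) {P : MvPolynomial (Fin 3) (Polynomial A)} (hP : CoeffsNatDegreeLE P 0) :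
      CoeffsNatDegreeLE (MvPolynomial.C (c (cubicIndex l j k m)) * P)
        (if l = i then 1 else 0) := .C_mul (hc (cubicIndex l j k m)) hP
  have x (j : Fin 3) := CoeffsNatDegreeLE.X (A := A) j
  unfold Ciani.cubicForm
  exact (((((((((h0 _ _ _ ((x 0).pow_zero 3)).add (h0 _ _ _ (((x 0).pow_zero 2).mul (x 1)))).add
    (h0 _ _ _ (((x 0).pow_zero 2).mul (x 2)))).add (h0 _ _ _ ((x 0).mul ((x 1).pow_zero 2)))).add
    (h0 _ _ _ (((x 0).mul (x 1)).mul (x 2)))).add (h0 _ _ _ ((x 0).mul ((x 2).pow_zero 2)))).add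
    (h0 _ _ _ ((x 1).pow_zero 3))).add (h0 _ _ _ (((x 1).pow_zero 2).mul (x 2)))).add
    (h0 _ _ _ ((x 1).mul ((x 2).pow_zero 2)))).add (h0 _ _ _ ((x 2).pow_zero 3))

theorem CoeffsNatDegreeLE.sylvesterA
    (hc : ∀ p, (c p).natDegree ≤ if p.1 = i then 1 else 0) (p s j : Fin 3) :
    CoeffsNatDegreeLE (sylvesterA c p s j) (if p + s = i then 1 else 0) := by
  have h1 (j k m : Fin 3) : (c (cubicIndex (p + s) j k m)).natDegree ≤
      if p + s = i then 1 else 0 := hc (cubicIndex (p + s) j k m)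
  have h0 (j k m : Fin 3) {P : MvPolynomial (Fin 3) (Polynomial A)} (hP : CoeffsNatDegreeLE P 0) :
      CoeffsNatDegreeLE (MvPolynomial.C (c (cubicIndex (p + s) j k m)) * P)
        (if p + s = i then 1 else 0) := .C_mul (h1 j k m) hP
  have x (j : Fin 3) := CoeffsNatDegreeLE.X (A := A) j
  have xx (j : Fin 3) := (x j).pow_zero 2
  have xy (j k : Fin 3) := (x j).mul (x k)
  fin_cases j
  · exact .C (h1 _ _ _)
  · exact (((((h0 _ _ _ (xx _)).add (h0 _ _ _ (xy _ _))).add (h0 _ _ _ (xy _ _))).add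
      (h0 _ _ _ (xx _))).add (h0 _ _ _ (xy _ _))).add (h0 _ _ _ (xx _))
  · exact ((h0 _ _ _ (xx _)).add (h0 _ _ _ (xy _ _))).add (h0 _ _ _ (xx _))

theorem CoeffsNatDegreeLE.sylvesterB
    (hc : ∀ p, (c p).natDegree ≤ if p.1 = i then 1 else 0) (p s j : Fin 3) :
    CoeffsNatDegreeLE (sylvesterB c p s j) (if p + s = i then 1 else 0) := by
  have h0 (j k m : Fin 3) {P : MvPolynomial (Fin 3) (Polynomial A)} (hP : CoeffsNatDegreeLE P 0) :
      CoeffsNatDegreeLE (MvPolynomial.C (c (cubicIndex (p + s) j k m)) * P)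
        (if p + s = i then 1 else 0) := .C_mul (hc (cubicIndex (p + s) j k m)) hP
  have x (j : Fin 3) := CoeffsNatDegreeLE.X (A := A) j
  have xx (j : Fin 3) := (x j).pow_zero 2
  have xy (j k : Fin 3) := (x j).mul (x k)
  fin_cases j
  · exact (((((h0 _ _ _ (xx _)).add (h0 _ _ _ (xy _ _))).add (h0 _ _ _ (xy _ _))).add
      (h0 _ _ _ (xx _))).add (h0 _ _ _ (xy _ _))).add (h0 _ _ _ (xx _))
  · exact (h0 _ _ _ (x _)).add (h0 _ _ _ (x _))
  · exact (h0 _ _ _ (x _)).add (h0 _ _ _ (x _))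

/-- Sylvester's determinant has degree at most nine in the coefficients of each form: three rows
are multiples of that form, and the six Sylvester forms are linear in each form. -/
theorem natDegree_det_sylvesterMatrix_le
    (hc : ∀ p, (c p).natDegree ≤ if p.1 = i then 1 else 0) :
    (sylvesterMatrix c).det.natDegree ≤ 9 := by
  have hsum (p : Fin 3) : ∑ s, (if p + s = i then 1 else 0) = 1 := by
    clear hc; revert p i; decide
  have hx (j l : Fin 3) : CoeffsNatDegreeLE (MvPolynomial.X j * Ciani.cubicForm c l)
      (if l = i then 1 else 0) := by
    simpa using (CoeffsNatDegreeLE.X j).mul (CoeffsNatDegreeLE.cubicForm hc l)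
  let d : QuarticIndex → ℕ
    | .inl (.inl p) => if p = i then 1 else 0
    | .inl (.inr _) => 1
    | .inr (s, p) => ![1, if p + 1 = i then 1 else 0, if p + 2 = i then 1 else 0] s
  have hd : ∑ r, d r = 9 := by
    clear hc hx hsum; revert i; decide
  rw [← hd]
  refine natDegree_det_le _ d fun r s => ?_
  suffices CoeffsNatDegreeLE (quarticRow c r) (d r) from this _
  rcases r with (p | p) | ⟨r, p⟩
  · exact hx _ _
  · have := CoeffsNatDegreeLE.det fun s j => CoeffsNatDegreeLE.sylvesterA hc p s j
    rwa [hsum p] at this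
  · fin_cases r
    · have := CoeffsNatDegreeLE.det fun s j => CoeffsNatDegreeLE.sylvesterB hc p s j
      rwa [hsum p] at this
    · exact hx _ _
    · exact hx _ _

end Degree

/-! ### The generic system with a common root -/

/-- The vector `(t₀, t₁, 1)`, with `t₀, t₁` two indeterminates. -/
noncomputable def genericRoot : Fin 3 → MvPolynomial (CubicIndex ⊕ Fin 2) ℤ :=
  ![X (.inr 0), X (.inr 1), 1]

/-- The value at `(t₀, t₁, 1)` of the `i`-th cubic with indeterminate coefficients. -/
noncomputable def genericValue (i : Fin 3) : MvPolynomial (CubicIndex ⊕ Fin 2) ℤ :=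
  eval genericRoot (cubicForm (fun p => X (.inl p)) i)

open Classical in
/-- The coefficients of the generic system of cubics with the root `(t₀, t₁, 1)`: the value at that
point is subtracted from the coefficient of `x₂³`. -/
noncomputable def genericPoint (p : CubicIndex) : MvPolynomial (CubicIndex ⊕ Fin 2) ℤ :=
  X (.inl p) - if p = cubicIndex p.1 2 2 2 then genericValue p.1 else 0

open Classical in
/-- Subtracting `aᵢ` from the coefficient of `x₂³` in the `i`-th cubic. -/
theorem cubicForm_sub_ite (c : CubicIndex → A) (a : Fin 3 → A) (i : Fin 3) :
    cubicForm (fun p => c p - if p = cubicIndex p.1 2 2 2 then a p.1 else 0) i =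
      cubicForm c i - C (a i) * X 2 ^ 3 := by
  have h1 (j k l : Fin 3) : (cubicIndex i j k l).1 = i := rfl
  simp only [cubicForm, h1, cubicIndex_inj, true_and]
  simp +decide
  ring

theorem eval_genericRoot_cubicForm (i : Fin 3) :
    eval genericRoot (cubicForm genericPoint i) = 0 := by
  have := cubicForm_sub_ite (fun p => X (.inl p)) genericValue i
  unfold genericPoint
  rw [this, map_sub, ← genericValue]
  simp [genericRoot]

theorem genericRoot_ne_zero : genericRoot ≠ 0 := fun h => by
  simpa [genericRoot] using congrFun h 2

/-- Every system over a field with a common root outside the line `x₂ = 0` is a specialization of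
the generic one. -/
theorem evalCoeffs_eq_zero_of_evalCoeffs_genericPoint {P : MvPolynomial CubicIndex ℤ}
    (hP : evalCoeffs genericPoint P = 0) {L : Type*} [Field L] (c : CubicIndex → L) (v : Fin 3 → L)
    (hv : v 2 ≠ 0) (h : ∀ i, eval v (cubicForm c i) = 0) : evalCoeffs c P = 0 := by
  let φ : MvPolynomial (CubicIndex ⊕ Fin 2) ℤ →+* L :=
    evalCoeffs (Sum.elim c ![v 0 / v 2, v 1 / v 2])
  have hφ : φ ∘ genericPoint = c := by
    have hval (i : Fin 3) : φ (genericValue i) = 0 := by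
      have := h i
      simp only [cubicForm, map_add, map_mul, map_pow, eval_C, eval_X] at this
      simp only [φ, genericValue, cubicForm, genericRoot, map_add, map_mul, map_pow, eval_C,
        eval_X, evalCoeffs_X, Sum.elim_inl, Sum.elim_inr, Matrix.cons_val, map_one]
      field_simp
      linear_combination this
    funext p
    simp only [Function.comp_apply, genericPoint, map_sub, apply_ite φ, hval, map_zero, ite_self, sub_zero]
    simp [φ]
  have := congrArg φ hP
  rw [map_zero, map_evalCoeffs, hφ] at this
  exact this

theorem IsMultivariateResultant.evalCoeffs_eq_zero {R : MvPolynomial CubicIndex ℤ}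
    (hR : IsMultivariateResultant (fun _ : Fin 3 => 3) R) {L : Type} [Field L]
    (c : CubicIndex → L) (v : Fin 3 → L) (hv : v ≠ 0) (h : ∀ i, eval v (cubicForm c i) = 0) :
    evalCoeffs c R = 0 := by
  have := hR.vanishes L (cubicForm c) (cubicForm_isHomogeneous _) ⟨v, hv, h⟩
  rwa [formCoeffs_cubicForm, aeval_eq_evalCoeffs] at this

theorem IsMultivariateResultant.evalCoeffs_genericPoint {R : MvPolynomial CubicIndex ℤ}
    (hR : IsMultivariateResultant (fun _ : Fin 3 => 3) R) : evalCoeffs genericPoint R = 0 := by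
  let S := MvPolynomial (CubicIndex ⊕ Fin 2) ℤ
  let ι : S →+* FractionRing S := algebraMap S (FractionRing S)
  have hι : Function.Injective ι := IsFractionRing.injective S (FractionRing S)
  have := hR.evalCoeffs_eq_zero (ι ∘ genericPoint) (ι ∘ genericRoot)
    (fun h => genericRoot_ne_zero ?_) fun i => ?_
  · apply hι
    rw [map_zero, ← this]
    exact map_evalCoeffs ι genericPoint R
  · funext t
    exact hι (by simpa using congrFun h t)
  · rw [← map_cubicForm, ← map_eval, eval_genericRoot_cubicForm, map_zero]

theorem evalCoeffs_genericPoint_sylvesterResultant : evalCoeffs genericPoint sylvesterResultant = 0 :=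
  evalCoeffs_sylvesterResultant_eq_zero _ _ genericRoot_ne_zero eval_genericRoot_cubicForm

/-! ### Lower bounds for the degree in each form -/

/-- The ring map that sends the coefficients `c` of the `i`-th form to `c + T c'`, with new
indeterminates `c'`. The degree in `T` of the image is the degree in the `i`-th form. -/
noncomputable def shiftForm (i : Fin 3) : MvPolynomial CubicIndex ℤ →+*
    Polynomial (MvPolynomial (CubicIndex ⊕ CubicIndex) ℤ) :=
  evalCoeffs fun p => Polynomial.C (X (.inl p)) +
    Polynomial.X * Polynomial.C (if p.1 = i then X (.inr p) else 0)

theorem map_shiftForm (i : Fin 3) (c c' : CubicIndex → A) (P : MvPolynomial CubicIndex ℤ) :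
    (shiftForm i P).map (evalCoeffs (Sum.elim c c')) =
    evalCoeffs (fun p => Polynomial.C (c p) +
      Polynomial.X * Polynomial.C (if p.1 = i then c' p else 0)) P := by
  refine (map_evalCoeffs (Polynomial.mapRingHom (evalCoeffs (Sum.elim c c'))) _ P).trans ?_
  congr 2
  funext p
  by_cases h : p.1 = i <;> simp [h]

theorem eval_map_shiftForm (i : Fin 3) (c c' : CubicIndex → A) (P : MvPolynomial CubicIndex ℤ)
    (a : A) : ((shiftForm i P).map (evalCoeffs (Sum.elim c c'))).eval a =
      evalCoeffs (fun p => c p + a * (if p.1 = i then c' p else 0)) P := by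
  rw [map_shiftForm]
  refine (map_evalCoeffs (Polynomial.evalRingHom a) _ P).trans ?_
  congr 2
  funext p
  simp [mul_comm a]

/-- The degree in the `i`-th form bounds the degree in `T` of the value at any system in which only
that form depends on `T`, and does so linearly. -/
theorem natDegree_evalCoeffs_le_natDegree_shiftForm {i : Fin 3} {c : CubicIndex → Polynomial A}
    (hc : ∀ p, (c p).natDegree ≤ if p.1 = i then 1 else 0) (P : MvPolynomial CubicIndex ℤ) :
    (evalCoeffs c P).natDegree ≤ (shiftForm i P).natDegree := by
  have h : c = fun p => Polynomial.C ((c p).coeff 0) +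
      Polynomial.X * Polynomial.C (if p.1 = i then (c p).coeff 1 else 0) := by
    funext p
    have hp := hc p
    split_ifs at hp ⊢ with h
    · conv_lhs => rw [Polynomial.eq_X_add_C_of_natDegree_le_one hp]
      ring
    · conv_lhs => rw [Polynomial.eq_C_of_natDegree_le_zero hp]
      simp
  conv_lhs => rw [h]
  rw [← map_shiftForm i (fun p => (c p).coeff 0) fun p => (c p).coeff 1]
  exact Polynomial.natDegree_map_le

theorem natDegree_shiftForm_sylvesterResultant_le (i : Fin 3) :
    (shiftForm i sylvesterResultant).natDegree ≤ 9 := by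
  have h : shiftForm i sylvesterResultant = (sylvesterMatrix _).det := evalCoeffs_sylvesterResultant _
  rw [h]
  refine natDegree_det_sylvesterMatrix_le (i := i) fun p => ?_
  split_ifs with h
  · refine (Polynomial.natDegree_add_le _ _).trans ?_
    simp only [Polynomial.natDegree_C]
    rw [Polynomial.X_mul]
    simp only [max_le_iff, zero_le, true_and]
    exact (Polynomial.natDegree_C_mul_le _ _).trans Polynomial.natDegree_X_le
  · simp

/-- A polynomial whose degree in the `i`-th form is zero does not depend on that form. -/
theorem evalCoeffs_congr_of_natDegree_shiftForm {i : Fin 3} {P : MvPolynomial CubicIndex ℤ}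
    (hP : (shiftForm i P).natDegree = 0) (c c' : CubicIndex → A)
    (h : ∀ p : CubicIndex, p.1 ≠ i → c p = c' p) : evalCoeffs c P = evalCoeffs c' P := by
  have h0 := eval_map_shiftForm i c (fun p => c' p - c p) P 0
  have h1 := eval_map_shiftForm i c (fun p => c' p - c p) P 1
  rw [Polynomial.eq_C_of_natDegree_eq_zero hP, Polynomial.map_C, Polynomial.eval_C] at h0 h1
  rw [h0] at h1
  simp only [zero_mul, add_zero, one_mul] at h1
  rw [h1]
  congr 2
  funext p
  split_ifs with hp
  · ring
  · rw [add_zero, h p hp]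

theorem eq_C_of_natDegree_shiftForm {P : MvPolynomial CubicIndex ℤ}
    (hP : ∀ i, (shiftForm i P).natDegree = 0) : ∃ a, P = C a := by
  -- The generic coefficients with those of the forms before the `i`-th replaced by zero.
  let z (i : Fin 3) (p : CubicIndex) : MvPolynomial CubicIndex ℤ := if p.1 < i then 0 else X p
  have h0 : evalCoeffs X P = evalCoeffs (z 1) P :=
    evalCoeffs_congr_of_natDegree_shiftForm (hP 0) _ _ fun p hp => by
      simp only [z]; rw [if_neg]; omega
  have h1 : evalCoeffs (z 1) P = evalCoeffs (z 2) P :=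
    evalCoeffs_congr_of_natDegree_shiftForm (hP 1) _ _ fun p hp => by
      simp only [z]; congr 1; simp only [eq_iff_iff]; omega
  have h2 : evalCoeffs (z 2) P = evalCoeffs (fun _ => (0 : MvPolynomial CubicIndex ℤ)) P :=
    evalCoeffs_congr_of_natDegree_shiftForm (hP 2) _ _ fun p hp => by
      simp only [z]; rw [if_pos]; omega
  have := h0.trans (h1.trans h2)
  rw [evalCoeffs_X_left] at this
  rw [← aeval_eq_evalCoeffs, aeval_zero'] at this
  exact ⟨_, this⟩

/-- A pencil of systems, in the parameter `τ`, for which the values `τ = 2 ε² (a + 3 b)`,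
`a, b ∈ {1, 2, 3}`, give a common root: with `xᵢ = 1`, the two other cubics have the nine common
roots `(x_{i+1}, x_{i+2}) = (a ε, b ε)`. For `ε = 0` it degenerates to cubes of variables. -/
noncomputable def testSystem (i : Fin 3) (ε τ : A) (l : Fin 3) : MvPolynomial (Fin 3) A :=
  if l = i then C ε * ((X (i + 1) + C 3 * X (i + 2)) * X i ^ 2) - C τ * X i ^ 3
  else (X l - C ε * X i) * (X l - C (2 * ε) * X i) * (X l - C (3 * ε) * X i)

theorem map_testSystem (φ : A →+* B) (i : Fin 3) (ε τ : A) (l : Fin 3) :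
    map φ (testSystem i ε τ l) = testSystem i (φ ε) (φ τ) l := by
  unfold testSystem
  split_ifs <;> simp [map_ofNat]

theorem testSystem_isHomogeneous (i : Fin 3) (ε τ : A) (l : Fin 3) :
    (testSystem i ε τ l).IsHomogeneous 3 := by
  have x (j : Fin 3) : (X j : MvPolynomial (Fin 3) A).IsHomogeneous 1 := isHomogeneous_X A j
  have key (a : A) {n : ℕ} {P : MvPolynomial (Fin 3) A} (hP : P.IsHomogeneous n) :
      (C a * P).IsHomogeneous n := by
    simpa using (isHomogeneous_C (Fin 3) a).mul hP
  unfold testSystem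
  split_ifs
  · exact (key _ (((x _).add (key _ (x _))).mul ((x _).pow 2))).sub (key _ ((x _).pow 3))
  · exact (((x _).sub (key _ (x _))).mul ((x _).sub (key _ (x _)))).mul ((x _).sub (key _ (x _)))

theorem formCoeffs_map (φ : A →+* B) (f : Fin 3 → MvPolynomial (Fin 3) A) :
    formCoeffs (fun _ : Fin 3 => 3) (fun i => map φ (f i)) =
      φ ∘ formCoeffs (fun _ : Fin 3 => 3) f :=
  funext fun _ => coeff_map _ _ _

theorem map_evalCoeffs_formCoeffs (φ : A →+* B) (f : Fin 3 → MvPolynomial (Fin 3) A)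
    (P : MvPolynomial CubicIndex ℤ) :
    φ (evalCoeffs (formCoeffs (fun _ : Fin 3 => 3) f) P) =
      evalCoeffs (formCoeffs (fun _ : Fin 3 => 3) fun i => map φ (f i)) P := by
  rw [map_evalCoeffs, formCoeffs_map]

theorem natDegree_formCoeffs_testSystem (i : Fin 3) (ε : ℤ) (p : CubicIndex) :
    (formCoeffs (fun _ : Fin 3 => 3) (testSystem i (Polynomial.C ε) Polynomial.X) p).natDegree ≤
      if p.1 = i then 1 else 0 := by
  have x (j : Fin 3) : CoeffsNatDegreeLE (X j : MvPolynomial (Fin 3) (Polynomial ℤ)) 0 := .X j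
  have hC (a : ℤ) {P : MvPolynomial (Fin 3) (Polynomial ℤ)} (hP : CoeffsNatDegreeLE P 0) :
      CoeffsNatDegreeLE (C (Polynomial.C a) * P) 0 := .C_mul (by simp) hP
  suffices CoeffsNatDegreeLE (testSystem i (Polynomial.C ε) Polynomial.X p.1)
    (if p.1 = i then 1 else 0) from this _
  unfold testSystem
  split_ifs with h
  · rw [sub_eq_add_neg]
    refine CoeffsNatDegreeLE.add (fun ν => ?_) (CoeffsNatDegreeLE.C_mul (by simp)
      ((x _).pow_zero 3)).neg
    exact (hC ε (((x _).add (hC 3 (x _))).mul ((x _).pow_zero 2)) ν).trans zero_le_one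
  · have key (a : ℤ) : CoeffsNatDegreeLE (X p.1 - C (Polynomial.C a) * X i) 0 := by
      rw [sub_eq_add_neg]
      exact (x _).add (hC a (x _)).neg
    have := ((key ε).mul (key (2 * ε))).mul (key (3 * ε))
    simpa using this

theorem eval_testSystem_eq_zero (i : Fin 3) (ε a b : A) (ha : (a - 1) * (a - 2) * (a - 3) = 0)
    (hb : (b - 1) * (b - 2) * (b - 3) = 0) (l : Fin 3) :
    eval (fun t => if t = i then 1 else if t = i + 1 then a * ε else b * ε)
      (testSystem i ε (ε * (a * ε + 3 * (b * ε))) l) = 0 := by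
  have h1 : i + 1 ≠ i := by revert i; decide
  have h2 : i + 2 ≠ i := by revert i; decide
  have h3 : i + 2 ≠ i + 1 := by revert i; decide
  have cover (k : Fin 3) : k = i ∨ k = i + 1 ∨ k = i + 2 := by revert i k; decide
  rcases cover l with rfl | rfl | rfl
  · simp [testSystem]
  · simp only [testSystem, h1]
    simp
    linear_combination ε ^ 3 * ha
  · simp only [testSystem, h2]
    simp [h2]
    linear_combination ε ^ 3 * hb

/-- A polynomial that vanishes at the generic system with a common root, but not (modulo 2) at the
cubes of the variables, has degree at least nine in each form. -/
theorem nine_le_natDegree_shiftForm {P : MvPolynomial CubicIndex ℤ}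
    (hP : evalCoeffs genericPoint P = 0)
    (h1 : IsUnit (evalCoeffs (formCoeffs (fun _ : Fin 3 => 3)
      fun i => (X i : MvPolynomial (Fin 3) ℤ) ^ 3) P)) (i : Fin 3) :
    9 ≤ (shiftForm i P).natDegree := by
  refine le_trans ?_ (natDegree_evalCoeffs_le_natDegree_shiftForm
    (natDegree_formCoeffs_testSystem i 2) P)
  set p : Polynomial ℤ := evalCoeffs (formCoeffs (fun _ : Fin 3 => 3)
    (testSystem i (Polynomial.C 2) Polynomial.X)) P with hp
  -- Modulo 2 and for `τ = -1` the test system consists of the cubes of the variables.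
  have hp0 : p ≠ 0 := by
    intro h0
    have h2 : Polynomial.eval₂RingHom (Int.castRingHom (ZMod 2)) (-1) p =
        evalCoeffs (formCoeffs (fun _ : Fin 3 => 3)
          fun i => (X i : MvPolynomial (Fin 3) (ZMod 2)) ^ 3) P := by
      rw [hp, map_evalCoeffs_formCoeffs]
      congr 3
      funext l
      rw [map_testSystem]
      have : (2 : ZMod 2) = 0 := rfl
      by_cases hl : l = i
      · simp [testSystem, hl, this, CharTwo.neg_eq]
      · simp [testSystem, hl, this]
        ring
    have h3 := map_evalCoeffs_formCoeffs (Int.castRingHom (ZMod 2))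
      (fun i => (X i : MvPolynomial (Fin 3) ℤ) ^ 3) P
    simp only [map_pow, map_X] at h3
    rw [← h3, h0, map_zero] at h2
    have := h1.map (Int.castRingHom (ZMod 2))
    rw [← h2] at this
    exact not_isUnit_zero this
  have hroot (a b : ℤ) (ha : (a - 1) * (a - 2) * (a - 3) = 0)
      (hb : (b - 1) * (b - 2) * (b - 3) = 0) : p.eval (2 * (a * 2 + 3 * (b * 2))) = 0 := by
    have haQ : ((a : ℚ) - 1) * (a - 2) * (a - 3) = 0 := by exact_mod_cast ha
    have hbQ : ((b : ℚ) - 1) * (b - 2) * (b - 3) = 0 := by exact_mod_cast hb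
    have ha0 : (a : ℚ) ≠ 0 := by intro h; norm_num [h] at haQ
    have hb0 : (b : ℚ) ≠ 0 := by intro h; norm_num [h] at hbQ
    have h2 : (Int.castRingHom ℚ) (Polynomial.evalRingHom (2 * (a * 2 + 3 * (b * 2))) p) =
        evalCoeffs (formCoeffs (fun _ : Fin 3 => 3)
          (testSystem i (2 : ℚ) (2 * (a * 2 + 3 * (b * 2))))) P := by
      rw [hp, map_evalCoeffs_formCoeffs, map_evalCoeffs_formCoeffs]
      congr 3
      funext l
      rw [map_testSystem, map_testSystem]
      simp
    rw [evalCoeffs_eq_zero_of_evalCoeffs_genericPoint hP _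
      (fun t => if t = i then 1 else if t = i + 1 then (a : ℚ) * 2 else b * 2)] at h2
    · exact Int.cast_eq_zero.1 h2
    · split_ifs <;> simp [ha0, hb0]
    · intro l
      rw [cubicForm_formCoeffs (testSystem_isHomogeneous _ _ _)]
      exact eval_testSystem_eq_zero i (2 : ℚ) a b haQ hbQ l
  -- The nine values `4 a + 12 b` with `a, b ∈ {1, 2, 3}`.
  let s : Finset ℤ := {16, 20, 24, 28, 32, 36, 40, 44, 48}
  have hs : s.val ⊆ p.roots := by
    intro x hx
    rw [Polynomial.mem_roots hp0, Polynomial.IsRoot]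
    have : x = 2 * (1 * 2 + 3 * (1 * 2)) ∨ x = 2 * (2 * 2 + 3 * (1 * 2)) ∨
        x = 2 * (3 * 2 + 3 * (1 * 2)) ∨ x = 2 * (1 * 2 + 3 * (2 * 2)) ∨
        x = 2 * (2 * 2 + 3 * (2 * 2)) ∨ x = 2 * (3 * 2 + 3 * (2 * 2)) ∨
        x = 2 * (1 * 2 + 3 * (3 * 2)) ∨ x = 2 * (2 * 2 + 3 * (3 * 2)) ∨
        x = 2 * (3 * 2 + 3 * (3 * 2)) := by
      simpa [s] using hx
    rcases this with rfl | rfl | rfl | rfl | rfl | rfl | rfl | rfl | rfl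
    all_goals exact hroot _ _ (by norm_num) (by norm_num)
  exact Polynomial.card_le_degree_of_subset_roots hs

/-! ### Sylvester's determinant is a resultant -/

/-- A factor of Sylvester's determinant vanishing at the generic system with a common root already
has the full degree nine in each form, so the cofactor is a constant. -/
theorem associated_sylvesterResultant_of_dvd {P : MvPolynomial CubicIndex ℤ}
    (hdvd : P ∣ sylvesterResultant) (hP : evalCoeffs genericPoint P = 0) :
    Associated P sylvesterResultant := by
  obtain ⟨E, hE⟩ := hdvd
  have h1 := congrArg (evalCoeffs (formCoeffs (fun _ : Fin 3 => 3)
    fun i => (X i : MvPolynomial (Fin 3) ℤ) ^ 3)) hE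
  rw [evalCoeffs_sylvesterResultant_powers, map_mul] at h1
  have hconst : ∀ i, (shiftForm i E).natDegree = 0 := fun i => by
    have h9 := nine_le_natDegree_shiftForm hP (.of_mul_eq_one _ h1.symm) i
    have hle := natDegree_shiftForm_sylvesterResultant_le i
    have hE0 : shiftForm i E ≠ 0 := fun h0 => by
      have h2 := eval_map_shiftForm i (formCoeffs (fun _ : Fin 3 => 3)
        fun i => (X i : MvPolynomial (Fin 3) ℤ) ^ 3) 0 E 0
      simp only [h0, Polynomial.map_zero, Polynomial.eval_zero, zero_mul, add_zero] at h2
      rw [← h2, mul_zero] at h1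
      exact one_ne_zero h1
    have hP0 : shiftForm i P ≠ 0 := fun h0 => by simp [h0] at h9
    rw [hE, map_mul, Polynomial.natDegree_mul hP0 hE0] at hle
    omega
  obtain ⟨e, rfl⟩ := eq_C_of_natDegree_shiftForm hconst
  rw [evalCoeffs_C, Int.cast_id] at h1
  have he : IsUnit e := .of_mul_eq_one _ ((mul_comm _ _).trans h1.symm)
  obtain ⟨u, hu⟩ := he.map (C : ℤ →+* MvPolynomial CubicIndex ℤ)
  exact ⟨u, by rw [hu, hE]⟩

theorem sylvesterResultant_ne_zero : sylvesterResultant ≠ 0 := fun h => by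
  have := evalCoeffs_sylvesterResultant_powers (A := ℤ)
  simp [h] at this

/-- The kernel of the specialization to the generic system is prime, so it contains an irreducible
factor of Sylvester's determinant, which is then associated to the determinant. -/
theorem irreducible_sylvesterResultant : Irreducible sylvesterResultant := by
  obtain ⟨f, hf, hassoc⟩ := WfDvdMonoid.exists_factors _ sylvesterResultant_ne_zero
  have h0 : evalCoeffs genericPoint f.prod = 0 := by
    obtain ⟨u, hu⟩ := hassoc.symm
    rw [← hu, map_mul, evalCoeffs_genericPoint_sylvesterResultant, zero_mul]
  rw [map_multiset_prod, Multiset.prod_eq_zero_iff, Multiset.mem_map] at h0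
  obtain ⟨P, hPf, hP0⟩ := h0
  exact (associated_sylvesterResultant_of_dvd
    ((Multiset.dvd_prod hPf).trans hassoc.dvd) hP0).irreducible (hf P hPf)

theorem isMultivariateResultant_sylvesterResultant :
    IsMultivariateResultant (fun _ : Fin 3 => 3) sylvesterResultant where
  irreducible := irreducible_sylvesterResultant
  vanishes L _ f hf := by
    rintro ⟨v, hv, h⟩
    rw [aeval_eq_evalCoeffs]
    exact evalCoeffs_sylvesterResultant_eq_zero _ v hv (by rwa [cubicForm_formCoeffs hf])
  normalized := (aeval_eq_evalCoeffs _ _).trans evalCoeffs_sylvesterResultant_powers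

/-! ### Uniqueness of the resultant -/

section Derivatives

variable {σ : Type*}

theorem pderiv_comm (i j : σ) (P : MvPolynomial σ A) :
    pderiv i (pderiv j P) = pderiv j (pderiv i P) := by
  classical
  ext m
  simp only [coeff_pderiv, Finsupp.add_apply, add_right_comm m]
  rcases eq_or_ne i j with rfl | h
  · rfl
  · simp [h, h.symm]
    ring

theorem totalDegree_pderiv_lt {i : σ} {P : MvPolynomial σ A} (h : pderiv i P ≠ 0) :
    (pderiv i P).totalDegree < P.totalDegree := by
  obtain ⟨m, hm, hmax⟩ := Finset.exists_mem_eq_sup _ (support_nonempty.2 h)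
    fun m => m.sum fun _ e => e
  rw [mem_support_iff, coeff_pderiv] at hm
  have := le_totalDegree (mem_support_iff.2 (left_ne_zero_of_mul hm))
  rw [totalDegree, hmax]
  rw [Finsupp.sum_add_index' (by simp) (by simp), Finsupp.sum_single_index rfl] at this
  omega

theorem apply_eq_zero_of_pderiv_eq_zero {i : σ} {P : MvPolynomial σ ℤ} (h : pderiv i P = 0)
    {m : σ →₀ ℕ} (hm : m ∈ P.support) : m i = 0 := by
  classical
  by_contra h0
  have hle : Finsupp.single i 1 ≤ m := by
    rw [Finsupp.single_le_iff]
    omega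
  have := congrArg (coeff (m - Finsupp.single i 1)) h
  rw [coeff_pderiv, tsub_add_cancel_of_le hle, coeff_zero] at this
  rcases mul_eq_zero.1 this with h1 | h1
  · exact mem_support_iff.1 hm h1
  · have : (0 : ℤ) < ((m - Finsupp.single i 1 : σ →₀ ℕ) i : ℤ) + 1 := by positivity
    push_cast at h1
    omega

theorem notMem_vars_of_pderiv_eq_zero {i : σ} {P : MvPolynomial σ ℤ} (h : pderiv i P = 0) :
    i ∉ P.vars := by
  rw [mem_vars_iff_mem_support]
  rintro ⟨m, hm, hi⟩
  exact Finsupp.mem_support_iff.1 hi (apply_eq_zero_of_pderiv_eq_zero h hm)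

end Derivatives

/-- Chain rule for the derivative of `P(genericPoint)` with respect to a coordinate of the root,
which enters only through the coefficients of `x₂³`. -/
theorem pderiv_evalCoeffs_genericPoint (j : Fin 2) (P : MvPolynomial CubicIndex ℤ) :
    pderiv (.inr j) (evalCoeffs genericPoint P) =
      -∑ i, evalCoeffs genericPoint (pderiv (cubicIndex i 2 2 2) P) *
        pderiv (.inr j) (genericValue i) := by
  classical
  set D : Fin 3 → MvPolynomial (CubicIndex ⊕ Fin 2) ℤ := fun i =>
    pderiv (.inr j) (genericValue i)
  have hX (p : CubicIndex) : pderiv (.inr j) (genericPoint p) =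
      -∑ i, (if p = cubicIndex i 2 2 2 then 1 else 0) * D i := by
    rw [Finset.sum_eq_single p.1]
    · rw [genericPoint, map_sub, pderiv_X_of_ne (by simp), zero_sub]
      split_ifs <;> simp [D]
    · intro i _ hi
      rw [if_neg fun h => hi (congrArg Sigma.fst h).symm, zero_mul]
    · simp
  induction P using MvPolynomial.induction_on with
  | C a => simp [Derivation.map_intCast]
  | add P Q hP hQ =>
    rw [map_add, map_add, hP, hQ, ← neg_add, ← Finset.sum_add_distrib]
    simp only [map_add, add_mul]
  | mul_X P p hP =>
    have hmul (i : Fin 3) : evalCoeffs genericPoint (pderiv (cubicIndex i 2 2 2) (P * X p)) =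
        evalCoeffs genericPoint (pderiv (cubicIndex i 2 2 2) P) * genericPoint p +
          evalCoeffs genericPoint P * if p = cubicIndex i 2 2 2 then 1 else 0 := by
      rw [pderiv_mul, map_add, map_mul, map_mul, evalCoeffs_X, pderiv_X, Pi.single_apply,
        apply_ite (evalCoeffs genericPoint), map_one, map_zero]
    rw [map_mul, evalCoeffs_X, pderiv_mul, hP, hX, neg_mul, mul_neg, ← neg_add, Finset.sum_mul,
      Finset.mul_sum, ← Finset.sum_add_distrib]
    congr 1
    refine Finset.sum_congr rfl fun i _ => ?_
    rw [hmul]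
    ring

/-- The Jacobian of the first two cubics with indeterminate coefficients is not zero. -/
theorem genericJacobian_ne_zero :
    pderiv (.inr 0) (genericValue 0) * pderiv (.inr 1) (genericValue 1) -
      pderiv (.inr 1) (genericValue 0) * pderiv (.inr 0) (genericValue 1) ≠ 0 := by
  classical
  intro h
  -- The cubics `x₀ x₂²` and `x₁ x₂²` have Jacobian `1` at `(0, 0, 1)`.
  have := congrArg (evalCoeffs (Sum.elim (fun p : CubicIndex =>
    if p = cubicIndex 0 0 2 2 ∨ p = cubicIndex 1 1 2 2 then (1 : ℤ) else 0) 0)) h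
  simp [genericValue, cubicForm, genericRoot, pderiv_X,
    cubicIndex_inj] at this
  revert this
  simp +decide

/-- A polynomial not involving the coefficient of `x₂³` in the last cubic vanishes at the generic
system with a common root only if it is zero: two general cubics have a common root, and that
coefficient can be chosen so that the last cubic vanishes there as well. -/
theorem eq_zero_of_pderiv_eq_zero {P : MvPolynomial CubicIndex ℤ}
    (hw : pderiv (cubicIndex 2 2 2 2) P = 0) (hP : evalCoeffs genericPoint P = 0) : P = 0 := by
  induction hn : P.totalDegree using Nat.strong_induction_on generalizing P with
  | _ n ih =>
    have hsmaller (i : Fin 3) (h0 : evalCoeffs genericPoint (pderiv (cubicIndex i 2 2 2) P) = 0) :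
        pderiv (cubicIndex i 2 2 2) P = 0 := by
      by_contra hne
      exact hne (ih _ (hn ▸ totalDegree_pderiv_lt hne) (by rw [pderiv_comm, hw, map_zero]) h0 rfl)
    have h (j : Fin 2) := pderiv_evalCoeffs_genericPoint j P
    simp only [hP, map_zero, Fin.sum_univ_three, hw, zero_mul, add_zero] at h
    have h0 := h 0
    have h1 := h 1
    have e0 : evalCoeffs genericPoint (pderiv (cubicIndex 0 2 2 2) P) = 0 := by
      refine (mul_eq_zero.1 ?_).resolve_right genericJacobian_ne_zero
      linear_combination (pderiv (.inr 1) (genericValue 1)) * h0 -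
        (pderiv (.inr 0) (genericValue 1)) * h1
    have e1 : evalCoeffs genericPoint (pderiv (cubicIndex 1 2 2 2) P) = 0 := by
      refine (mul_eq_zero.1 ?_).resolve_right genericJacobian_ne_zero
      linear_combination (pderiv (.inr 0) (genericValue 0)) * h1 -
        (pderiv (.inr 1) (genericValue 0)) * h0
    have hall (i : Fin 3) : pderiv (cubicIndex i 2 2 2) P = 0 := by
      fin_cases i
      · exact hsmaller 0 e0
      · exact hsmaller 1 e1
      · exact hw
    have : evalCoeffs genericPoint P = rename Sum.inl P := by
      have h : evalCoeffs genericPoint P = evalCoeffs (X ∘ Sum.inl) P := by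
        refine eval₂Hom_congr' rfl (fun p hp _ => ?_) rfl
        have hne : p ≠ cubicIndex p.1 2 2 2 := fun h =>
          notMem_vars_of_pderiv_eq_zero (hall p.1) (h ▸ hp)
        rw [genericPoint, if_neg hne, sub_zero]
        rfl
      conv_rhs => rw [← evalCoeffs_X_left P]
      rw [h]
      refine Eq.trans ?_ (map_evalCoeffs (rename Sum.inl : _ →ₐ[ℤ] _).toRingHom X P).symm
      congr 2
      funext p
      exact (rename_X _ p).symm
    rw [hP] at this
    exact rename_injective _ Sum.inl_injective (by rw [← this, map_zero])

open Polynomial in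
/-- Two irreducible polynomials over a factorial domain, of positive degree and not associated,
generate an ideal with a non-zero constant. -/
theorem exists_C_eq_of_not_associated {R : Type*} [CommRing R] [IsDomain R]
    [NormalizedGCDMonoid R] {p q : Polynomial R} (hp : Irreducible p) (hq : Irreducible q)
    (hp0 : p.natDegree ≠ 0) (hq0 : q.natDegree ≠ 0) (h : ¬ Associated p q) :
    ∃ r : R, r ≠ 0 ∧ ∃ a b : Polynomial R, a * p + b * q = Polynomial.C r := by
  have hp1 := hp.isPrimitive hp0
  have hq1 := hq.isPrimitive hq0
  let K := FractionRing R
  have hpK := (hp1.irreducible_iff_irreducible_map_fraction_map (K := K)).1 hp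
  have hqK := (hq1.irreducible_iff_irreducible_map_fraction_map (K := K)).1 hq
  have hcop : IsCoprime (p.map (algebraMap R K)) (q.map (algebraMap R K)) := by
    rw [hpK.coprime_iff_not_dvd]
    intro hdvd
    exact h (hp.associated_of_dvd hq (hp1.dvd_of_fraction_map_dvd_fraction_map hdvd))
  obtain ⟨a, b, hab⟩ := hcop
  obtain ⟨r, hr, ha⟩ := IsLocalization.integerNormalization_spec (nonZeroDivisors R) a
  obtain ⟨s, hs, hb⟩ := IsLocalization.integerNormalization_spec (nonZeroDivisors R) b
  refine ⟨r * s, mul_ne_zero (nonZeroDivisors.ne_zero hr) (nonZeroDivisors.ne_zero hs),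
    Polynomial.C s * IsLocalization.integerNormalization (nonZeroDivisors R) a,
    Polynomial.C r * IsLocalization.integerNormalization (nonZeroDivisors R) b, ?_⟩
  apply Polynomial.map_injective (algebraMap R K) (IsFractionRing.injective R K)
  simp only [Polynomial.map_add, Polynomial.map_mul, Polynomial.map_C, ha, hb,
    Algebra.smul_def, Polynomial.algebraMap_apply, map_mul]
  linear_combination (Polynomial.C (algebraMap R K r) * Polynomial.C (algebraMap R K s)) * hab

/-- The ring of polynomials in the coefficients of three cubics, as a ring of univariate polynomials
in the coefficient of `x₂³` in the last cubic. -/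
noncomputable def lastCoeffEquiv : MvPolynomial CubicIndex ℤ ≃ₐ[ℤ]
    Polynomial (MvPolynomial {p : CubicIndex // p ≠ cubicIndex 2 2 2 2} ℤ) :=
  open Classical in
  (renameEquiv ℤ (Equiv.optionSubtypeNe (cubicIndex 2 2 2 2)).symm).trans (optionEquivLeft ℤ _)

theorem pderiv_lastCoeffEquiv_symm_C
    (r : MvPolynomial {p : CubicIndex // p ≠ cubicIndex 2 2 2 2} ℤ) :
    pderiv (cubicIndex 2 2 2 2) (lastCoeffEquiv.symm (Polynomial.C r)) = 0 := by
  classical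
  have : lastCoeffEquiv.symm (Polynomial.C r) = rename Subtype.val r := by
    rw [AlgEquiv.symm_apply_eq]
    induction r using MvPolynomial.induction_on with
    | C a => simp [lastCoeffEquiv]
    | add P Q hP hQ => rw [map_add, map_add, map_add, hP, hQ]
    | mul_X P p hP =>
      rw [map_mul, map_mul, map_mul, hP]
      simp [lastCoeffEquiv, Equiv.optionSubtypeNe_symm_of_ne p.2]
  rw [this]
  apply pderiv_eq_zero_of_notMem_vars
  intro h
  obtain ⟨p, -, hp⟩ := Finset.mem_image.1 (vars_rename _ _ h)
  exact p.2 hp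

/-- Non-zero polynomials vanishing at the generic system involve the coefficient of `x₂³` in the last
cubic. -/
theorem natDegree_lastCoeffEquiv_ne_zero {P : MvPolynomial CubicIndex ℤ} (hP0 : P ≠ 0)
    (hP : evalCoeffs genericPoint P = 0) : (lastCoeffEquiv P).natDegree ≠ 0 := fun h => by
  refine hP0 (eq_zero_of_pderiv_eq_zero ?_ hP)
  have h1 := pderiv_lastCoeffEquiv_symm_C ((lastCoeffEquiv P).coeff 0)
  rwa [← Polynomial.eq_C_of_natDegree_eq_zero h, AlgEquiv.symm_apply_apply] at h1

/-- The prime ideal of the polynomials vanishing at the generic system with a common root has height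
one: two non-associated irreducible elements would produce, by elimination, a non-zero element
without the coefficient of `x₂³` in the last cubic. -/
theorem associated_of_irreducible {P Q : MvPolynomial CubicIndex ℤ} (hP : Irreducible P)
    (hQ : Irreducible Q) (hP0 : evalCoeffs genericPoint P = 0)
    (hQ0 : evalCoeffs genericPoint Q = 0) : Associated P Q := by
  classical
  by_contra hne
  have := UniqueFactorizationMonoid.strongNormalizationMonoid
    (α := MvPolynomial {p : CubicIndex // p ≠ cubicIndex 2 2 2 2} ℤ)
  have := UniqueFactorizationMonoid.toNormalizedGCDMonoid
    (MvPolynomial {p : CubicIndex // p ≠ cubicIndex 2 2 2 2} ℤ)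
  obtain ⟨r, hr, a, b, hab⟩ := exists_C_eq_of_not_associated
    ((MulEquiv.irreducible_iff lastCoeffEquiv).2 hP)
    ((MulEquiv.irreducible_iff lastCoeffEquiv).2 hQ)
    (natDegree_lastCoeffEquiv_ne_zero hP.ne_zero hP0)
    (natDegree_lastCoeffEquiv_ne_zero hQ.ne_zero hQ0)
    fun h => hne (by simpa using h.map lastCoeffEquiv.symm)
  have hmem : evalCoeffs genericPoint (lastCoeffEquiv.symm (Polynomial.C r)) = 0 := by
    rw [← hab, map_add, map_mul, map_mul, AlgEquiv.symm_apply_apply, AlgEquiv.symm_apply_apply,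
      map_add, map_mul, map_mul, hP0, hQ0, mul_zero, mul_zero, add_zero]
  have := eq_zero_of_pderiv_eq_zero (pderiv_lastCoeffEquiv_symm_C r) hmem
  rw [map_eq_zero_iff _ lastCoeffEquiv.symm.injective, Polynomial.C_eq_zero] at this
  exact hr this

theorem IsMultivariateResultant.eq_sylvesterResultant {R : MvPolynomial CubicIndex ℤ}
    (hR : IsMultivariateResultant (fun _ : Fin 3 => 3) R) : R = sylvesterResultant := by
  obtain ⟨u, hu⟩ := associated_of_irreducible irreducible_sylvesterResultant hR.irreducible
    evalCoeffs_genericPoint_sylvesterResultant hR.evalCoeffs_genericPoint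
  obtain ⟨e, -, he⟩ := MvPolynomial.isUnit_iff_eq_C_of_isReduced.1 u.isUnit
  rw [he] at hu
  have h1 := hR.normalized
  rw [← hu, aeval_eq_evalCoeffs, map_mul, evalCoeffs_sylvesterResultant_powers, evalCoeffs_C,
    one_mul, Int.cast_id] at h1
  rw [← hu, h1, C_1, mul_one]

theorem existsUnique_isMultivariateResultant :
    ∃! R, IsMultivariateResultant (fun _ : Fin 3 => 3) R :=
  ⟨sylvesterResultant, isMultivariateResultant_sylvesterResultant,
    fun _ hR => hR.eq_sylvesterResultant⟩

theorem multivariateResultant_eq :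
    multivariateResultant (fun _ : Fin 3 => 3) = sylvesterResultant :=
  (Classical.epsilon_spec ⟨_, isMultivariateResultant_sylvesterResultant⟩ :
    IsMultivariateResultant _ _).eq_sylvesterResultant

/-! ### Ciani quartics -/

section Discriminant

variable {A : Type*} [CommRing A] (a₁ a₂ a₃ b₁ b₂ b₃ : A)

/-- Up to the factor `4`, the partial derivatives are the forms `xᵢ (∑ₖ mᵢₖ xₖ²)`. -/
theorem pderiv_cianiForm (i : Fin 3) :
    pderiv i (cianiForm (symMatrix a₁ a₂ a₃ b₁ b₂ b₃)) =
      evenSystem (symMatrix (4 * a₁) (4 * a₂) (4 * a₃) (4 * b₁) (4 * b₂) (4 * b₃)) i := by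
  fin_cases i <;>
    simp [cianiForm, evenSystem, symMatrix, Fin.sum_univ_three, pderiv_X, map_ofNat C] <;> ring

theorem disc_cianiForm :
    disc 4 (cianiForm (symMatrix a₁ a₂ a₃ b₁ b₂ b₃)) =
      2 ^ 54 * (a₁ * a₂ * a₃ * ((a₂ * a₃ - b₁ ^ 2) * (a₁ * a₃ - b₂ ^ 2) * (a₁ * a₂ - b₃ ^ 2)) ^ 2 *
        (symMatrix a₁ a₂ a₃ b₁ b₂ b₃).det ^ 4) := by
  change aeval (formCoeffs (fun _ : Fin 3 => 3) _) (multivariateResultant fun _ : Fin 3 => 3) = _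
  rw [multivariateResultant_eq, aeval_eq_evalCoeffs]
  simp only [pderiv_cianiForm]
  rw [evalCoeffs_sylvesterResultant, det_sylvesterMatrix_evenSystem, Matrix.det_fin_three,
    Matrix.det_fin_three]
  simp [symMatrix]
  ring

end Discriminant

section Singular

variable {F : Type*} [Field F]

/-- The solutions `w` of `wᵢ (∑ₖ mᵢₖ wₖ) = 0` are kernel vectors of principal submatrices of `m`, so
there is a non-zero one exactly when a principal minor vanishes. -/
theorem exists_mul_mulVec_eq_zero_iff (a₁ a₂ a₃ b₁ b₂ b₃ : F) :
    (∃ w : Fin 3 → F, w ≠ 0 ∧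
      ∀ i, w i * ∑ k, symMatrix a₁ a₂ a₃ b₁ b₂ b₃ i k * w k = 0) ↔
    a₁ * a₂ * a₃ * ((a₂ * a₃ - b₁ ^ 2) * (a₁ * a₃ - b₂ ^ 2) * (a₁ * a₂ - b₃ ^ 2)) *
      (symMatrix a₁ a₂ a₃ b₁ b₂ b₃).det = 0 := by
  have two (a a' b : F) (h : a * a' - b ^ 2 = 0) :
      ∃ s t : F, (s ≠ 0 ∨ t ≠ 0) ∧ a * s + b * t = 0 ∧ b * s + a' * t = 0 := by
    by_cases ha : a = 0
    · have hb : b = 0 := by simpa [ha] using h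
      exact ⟨1, 0, by simp, by simp [ha], by simp [hb]⟩
    · exact ⟨-b, a, .inr ha, by ring, by linear_combination h⟩
  constructor
  · rintro ⟨w, hw, h⟩
    have e0 := h 0
    have e1 := h 1
    have e2 := h 2
    simp only [symMatrix, Fin.sum_univ_three, Matrix.of_apply, Matrix.cons_val] at e0 e1 e2
    have hne : w 0 ≠ 0 ∨ w 1 ≠ 0 ∨ w 2 ≠ 0 := by
      by_contra! h0
      exact hw (funext fun i => by fin_cases i <;> simp [h0])
    by_cases hdet : (symMatrix a₁ a₂ a₃ b₁ b₂ b₃).det = 0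
    · rw [hdet, mul_zero]
    have hdet' : ¬ (w 0 ≠ 0 ∧ w 1 ≠ 0 ∧ w 2 ≠ 0) := by
      rintro ⟨h0, h1, h2⟩
      refine hdet (Matrix.exists_mulVec_eq_zero_iff.1 ⟨w, hw, funext fun i => ?_⟩)
      refine (mul_eq_zero.1 (h i)).resolve_left ?_
      fin_cases i <;> assumption
    by_cases h0 : w 0 = 0 <;> by_cases h1 : w 1 = 0 <;> by_cases h2 : w 2 = 0 <;>
      simp [h0, h1, h2] at e0 e1 e2 hne hdet'
    · simp [e2]
    · simp [e1]
    · have : a₂ * a₃ - b₁ ^ 2 = 0 := by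
        refine (mul_eq_zero.1 (?_ : _ * w 1 = 0)).resolve_right h1
        linear_combination a₃ * e1 - b₁ * e2
      simp [this]
    · simp [e0]
    · have : a₁ * a₃ - b₂ ^ 2 = 0 := by
        refine (mul_eq_zero.1 (?_ : _ * w 0 = 0)).resolve_right h0
        linear_combination a₃ * e0 - b₂ * e2
      simp [this]
    · have : a₁ * a₂ - b₃ ^ 2 = 0 := by
        refine (mul_eq_zero.1 (?_ : _ * w 0 = 0)).resolve_right h0
        linear_combination a₂ * e0 - b₃ * e1
      simp [this]
  · intro h
    simp only [mul_eq_zero] at h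
    rcases h with (((h | h) | h) | ((h | h) | h)) | h
    · exact ⟨![1, 0, 0], fun h0 => by simpa using congrFun h0 0, fun i => by
        fin_cases i <;> simp [symMatrix, Fin.sum_univ_three, h]⟩
    · exact ⟨![0, 1, 0], fun h0 => by simpa using congrFun h0 1, fun i => by
        fin_cases i <;> simp [symMatrix, Fin.sum_univ_three, h]⟩
    · exact ⟨![0, 0, 1], fun h0 => by simpa using congrFun h0 2, fun i => by
        fin_cases i <;> simp [symMatrix, Fin.sum_univ_three, h]⟩
    · obtain ⟨s, t, hst, hs, ht⟩ := two _ _ _ h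
      refine ⟨![0, s, t], fun h0 => ?_, fun i => ?_⟩
      · have h1 : s = 0 := congrFun h0 1
        have h2 : t = 0 := congrFun h0 2
        simp [h1, h2] at hst
      · fin_cases i <;> simp [symMatrix, Fin.sum_univ_three, hs, ht]
    · obtain ⟨s, t, hst, hs, ht⟩ := two _ _ _ h
      refine ⟨![s, 0, t], fun h0 => ?_, fun i => ?_⟩
      · have h1 : s = 0 := congrFun h0 0
        have h2 : t = 0 := congrFun h0 2
        simp [h1, h2] at hst
      · fin_cases i <;> simp [symMatrix, Fin.sum_univ_three, hs, ht]
    · obtain ⟨s, t, hst, hs, ht⟩ := two _ _ _ h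
      refine ⟨![s, t, 0], fun h0 => ?_, fun i => ?_⟩
      · have h1 : s = 0 := congrFun h0 0
        have h2 : t = 0 := congrFun h0 1
        simp [h1, h2] at hst
      · fin_cases i <;> simp [symMatrix, Fin.sum_univ_three, hs, ht]
    · obtain ⟨w, hw, h0⟩ := Matrix.exists_mulVec_eq_zero_iff.2 h
      exact ⟨w, hw, fun i => mul_eq_zero_of_right _ (congrFun h0 i)⟩

/-- Over an algebraically closed field every vector consists of squares. -/
theorem exists_mul_sum_sq_eq_zero_iff [IsAlgClosed F] (n : Matrix (Fin 3) (Fin 3) F) :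
    (∃ v : Fin 3 → F, v ≠ 0 ∧ ∀ i, v i * ∑ k, n i k * v k ^ 2 = 0) ↔
      ∃ w : Fin 3 → F, w ≠ 0 ∧ ∀ i, w i * ∑ k, n i k * w k = 0 := by
  constructor
  · rintro ⟨v, hv, h⟩
    refine ⟨fun i => v i ^ 2, fun h0 => hv (funext fun i => ?_), fun i => ?_⟩
    · simpa using congrFun h0 i
    · dsimp only
      rw [pow_two, mul_assoc, h i, mul_zero]
  · rintro ⟨w, hw, h⟩
    choose v hv using fun i => IsAlgClosed.exists_pow_nat_eq (w i) (n := 2) two_pos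
    refine ⟨v, fun h0 => hw (funext fun i => ?_), fun i => ?_⟩
    · rw [← hv, h0]
      simp
    · simp only [hv]
      rcases mul_eq_zero.1 (h i) with h1 | h1
      · rw [← hv] at h1
        simp [pow_eq_zero_iff two_ne_zero |>.1 h1]
      · rw [h1, mul_zero]

theorem isNonsingularPlaneCurve_cianiForm_iff (hF : (2 : F) ≠ 0) (a₁ a₂ a₃ b₁ b₂ b₃ : F) :
    IsNonsingularPlaneCurve (cianiForm (symMatrix a₁ a₂ a₃ b₁ b₂ b₃)) ↔
    a₁ * a₂ * a₃ * ((a₂ * a₃ - b₁ ^ 2) * (a₁ * a₃ - b₂ ^ 2) * (a₁ * a₂ - b₃ ^ 2)) *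
      (symMatrix a₁ a₂ a₃ b₁ b₂ b₃).det ≠ 0 := by
  let φ := algebraMap F (AlgebraicClosure F)
  set n := symMatrix (φ a₁) (φ a₂) (φ a₃) (φ b₁) (φ b₂) (φ b₃) with hn
  have h4 : (4 : AlgebraicClosure F) ≠ 0 := by
    have : φ (2 * 2) ≠ 0 := (map_ne_zero φ).2 (mul_ne_zero hF hF)
    rw [map_mul, map_ofNat] at this
    norm_num at this ⊢
    exact this
  have hpartial (v : Fin 3 → AlgebraicClosure F) (i : Fin 3) :
      aeval v (pderiv i (cianiForm (symMatrix a₁ a₂ a₃ b₁ b₂ b₃))) =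
        4 * (v i * ∑ k, n i k * v k ^ 2) := by
    rw [pderiv_cianiForm]
    fin_cases i <;> simp [evenSystem, symMatrix, Fin.sum_univ_three, hn, φ, map_ofNat (algebraMap F _)] <;> ring
  have hform (v : Fin 3 → AlgebraicClosure F) :
      aeval v (cianiForm (symMatrix a₁ a₂ a₃ b₁ b₂ b₃)) =
        ∑ i, v i * (v i * ∑ k, n i k * v k ^ 2) := by
    simp [cianiForm, symMatrix, Fin.sum_univ_three, hn, φ]
    ring
  have hdet : a₁ * a₂ * a₃ * ((a₂ * a₃ - b₁ ^ 2) * (a₁ * a₃ - b₂ ^ 2) * (a₁ * a₂ - b₃ ^ 2)) *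
      (symMatrix a₁ a₂ a₃ b₁ b₂ b₃).det = 0 ↔
      ∃ v : Fin 3 → AlgebraicClosure F, v ≠ 0 ∧ ∀ i, v i * ∑ k, n i k * v k ^ 2 = 0 := by
    rw [exists_mul_sum_sq_eq_zero_iff, hn, exists_mul_mulVec_eq_zero_iff, ← map_eq_zero φ,
      Matrix.det_fin_three, Matrix.det_fin_three]
    simp [symMatrix]
  rw [ne_eq, hdet]
  constructor
  · rintro h ⟨v, hv, hz⟩
    obtain ⟨i, hi⟩ := h v hv (by simp [hform, hz])
    exact hi (by rw [hpartial, hz, mul_zero])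
  · intro h v hv _
    by_contra! hz
    refine h ⟨v, hv, fun i => ?_⟩
    have := hz i
    rw [hpartial] at this
    exact (mul_eq_zero.1 this).resolve_left h4

end Singular

end Ciani

theorem mainTheorem5 {K : Type*} [Field K] (hK : ringChar K ≠ 2)
    (a₁ a₂ a₃ b₁ b₂ b₃ c₁ c₂ c₃ : K)
    (hc₁ : c₁ = a₂ * a₃ - b₁ ^ 2) (hc₂ : c₂ = a₁ * a₃ - b₂ ^ 2) (hc₃ : c₃ = a₁ * a₂ - b₃ ^ 2)
    (m : Matrix (Fin 3) (Fin 3) K) (hm : m = Ciani.symMatrix a₁ a₂ a₃ b₁ b₂ b₃) :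
    (∃! R, Ciani.IsMultivariateResultant (fun _ : Fin 3 => 3) R) ∧
    Ciani.disc 4 (Ciani.cianiForm m) =
      2 ^ 54 * (a₁ * a₂ * a₃ * (c₁ * c₂ * c₃) ^ 2 * m.det ^ 4) ∧
    (Ciani.IsNonsingularPlaneCurve (Ciani.cianiForm m) ↔
      a₁ * a₂ * a₃ * (c₁ * c₂ * c₃) * m.det ≠ 0) := by
  subst hc₁ hc₂ hc₃ hm
  exact ⟨Ciani.existsUnique_isMultivariateResultant, Ciani.disc_cianiForm ..,
    Ciani.isNonsingularPlaneCurve_cianiForm_iff (Ring.two_ne_zero hK) ..⟩
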